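/- Let $G=(V,E)$ be a finite simple graph with edge weights $w\in\mathbb R^E_{\ge 0}$. A \emph{fractional matching} of $G$ is a feasible solution of the linear program $$\nu_f(G)=\max\{\,w^\top x : x(\delta(v))\le 1 \text{ for all } v\in V,\ x\ge 0\,\},\qquad x\in\mathbb R^E,$$ where $\delta(v)$ is the set of edges incident to $v$ and $x(F)=\sum_{e\in F}x_e$; it is \emph{basic} if it is a basic feasible solution of this program, and \emph{maximum-weight} if it attains the maximum. For a basic fractional matching $x$ let $\mathscr C(x)$ be the set of odd cycles $C$ of $G$ with $x_e=\tfrac12$ for every edge $e$ of $C$, and let $$\gamma(G)=\min\{\,|\mathscr C(x)| : x \text{ is a basic maximum-weight fractional matching of } G\,\}.$$ Let $\nu(G)$ be the maximum weight of a matching of $G$. The weighted graph $G$ is \emph{stable} if $\nu(G)=\nu_f(G)$. For $S\subseteq V$ let $G\setminus S=G[V\setminus S]$ with the inherited weights, and call $S$ a \emph{vertex-stabilizer} of $G$ if $G\setminus S$ is stable. Then: 1. for every vertex $v\in V$, $\gamma(G\setminus v)\ge\gamma(G)-1$, where $G\setminus v=G\setminus\{v\}$; 2. every vertex-stabilizer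 $S$ of $G$ satisfies $|S|\ge\gamma(G)$. -/

import Mathlib

/-! A weighted graph is a simple graph `G` on a finite vertex set `V` together with `w : Sym2 V → ℝ`.
Only the values of `w` on the edges of `G` ever enter; they are required to be nonnegative.
All sums `∑ᶠ` below are finite sums, because `V` is finite. -/

namespace WGraph

variable {V : Type*}

/-- `δ(v)`: the edges of `G` incident to `v`. -/
def delta (G : SimpleGraph V) (v : V) : Set G.edgeSet := {e | v ∈ (e : Sym2 V)}

/-- The value `wᵀ x` of a vector `x ∈ ℝ^E`. -/
noncomputable def value (G : SimpleGraph V) (w : Sym2 V → ℝ) (x : G.edgeSet → ℝ) : ℝ :=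
  ∑ᶠ e : G.edgeSet, w e * x e

/-- Fractional matchings: feasible solutions of
`max { wᵀ x : x(δ(v)) ≤ 1 for all v ∈ V, x ≥ 0 }`. -/
def IsFractionalMatching (G : SimpleGraph V) (x : G.edgeSet → ℝ) : Prop :=
  (∀ e, 0 ≤ x e) ∧ ∀ v, ∑ᶠ e ∈ delta G v, x e ≤ 1

/-- `ν_f(G)`, the value of a maximum-weight fractional matching. -/
noncomputable def nuF (G : SimpleGraph V) (w : Sym2 V → ℝ) : ℝ :=
  sSup {r | ∃ x, IsFractionalMatching G x ∧ r = value G w x}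

/-- `ν(G)`, the value of a maximum-weight matching. -/
noncomputable def nu (G : SimpleGraph V) (w : Sym2 V → ℝ) : ℝ :=
  sSup {r | ∃ M : G.Subgraph, M.IsMatching ∧ r = ∑ᶠ e ∈ M.edgeSet, w e}

/-- A weighted graph is stable if `ν(G) = ν_f(G)`. -/
def IsStable (G : SimpleGraph V) (w : Sym2 V → ℝ) : Prop :=
  nu G w = nuF G w

/-- Basic fractional matchings, i.e. basic feasible solutions of the linear program: feasible
points at which the coefficient vectors of the tight constraints (`x(δ(v)) ≤ 1`, whose vector is
the indicator of `δ(v)`, and `x_e ≥ 0`, whose vector is the unit vector of `e`) span `ℝ^E`. -/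
def IsBasic (G : SimpleGraph V) (x : G.edgeSet → ℝ) : Prop :=
  IsFractionalMatching G x ∧
    Submodule.span ℝ
      ({a | ∃ v, ∑ᶠ e ∈ delta G v, x e = 1 ∧ a = Set.indicator (delta G v) 1} ∪
        {a | ∃ e, x e = 0 ∧ a = Set.indicator {e} 1} : Set (G.edgeSet → ℝ)) = ⊤

/-- Basic maximum-weight fractional matchings. -/
def IsBasicMax (G : SimpleGraph V) (w : Sym2 V → ℝ) (x : G.edgeSet → ℝ) : Prop :=
  IsBasic G x ∧ ∀ x', IsFractionalMatching G x' → value G w x' ≤ value G w x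

/-- `𝒞(x)`: the odd cycles of `G` all of whose edges `e` have `x_e = 1/2`.
A cycle is identified with its edge set. -/
def oddCycles (G : SimpleGraph V) (x : G.edgeSet → ℝ) : Set (Set G.edgeSet) :=
  {C | (∀ e ∈ C, x e = 1 / 2) ∧
    ∃ (u : V) (p : G.Walk u u), p.IsCycle ∧ Odd p.length ∧ C = {e | (e : Sym2 V) ∈ p.edges}}

/-- `γ(G)`: the minimum of `|𝒞(x)|` over all basic maximum-weight fractional matchings `x`.
This minimum is over a nonempty set, see `exists_isBasicMax`. -/
noncomputable def gamma (G : SimpleGraph V) (w : Sym2 V → ℝ) : ℕ :=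
  sInf {k | ∃ x, IsBasicMax G w x ∧ k = (oddCycles G x).ncard}

/-- The vertex-deleted graph `G ∖ S = G[V ∖ S]`. -/
abbrev deleteVerts (G : SimpleGraph V) (S : Set V) : SimpleGraph (Sᶜ : Set V) :=
  G.induce Sᶜ

/-- The edge weights inherited by `G ∖ S`. -/
def deleteWeight (w : Sym2 V → ℝ) (S : Set V) : Sym2 (Sᶜ : Set V) → ℝ :=
  fun e => w (e.map Subtype.val)

/-- `S` is a vertex-stabilizer if `G ∖ S` is stable. -/
def IsVertexStabilizer (G : SimpleGraph V) (w : Sym2 V → ℝ) (S : Set V) : Prop :=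
  IsStable (deleteVerts G S) (deleteWeight w S)

theorem isFractionalMatching_iff_sum [Finite V] (G : SimpleGraph V) [Fintype G.edgeSet]
    [∀ v, DecidablePred (· ∈ delta G v)] (x : G.edgeSet → ℝ) :
    IsFractionalMatching G x ↔
      (∀ e, 0 ≤ x e) ∧ ∀ v, ∑ e, Set.indicator (delta G v) x e ≤ 1 := by
  have h : ∀ v, ∑ᶠ e ∈ delta G v, x e = ∑ e, Set.indicator (delta G v) x e := fun v => by
    rw [finsum_mem_def, finsum_eq_sum_of_fintype]
  simp only [IsFractionalMatching, h]

/-- Basic maximum-weight fractional matchings exist, so that `γ` is a genuine minimum. -/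
theorem exists_isBasicMax [Finite V] (G : SimpleGraph V) (w : Sym2 V → ℝ) :
    ∃ x, IsBasicMax G w x := by
  classical
  have := Fintype.ofFinite V
  let P : Set (G.edgeSet → ℝ) := {x | IsFractionalMatching G x}
  have hP : P = {x | (∀ e, 0 ≤ x e) ∧ ∀ v, ∑ e, Set.indicator (delta G v) x e ≤ 1} := by
    ext x; exact isFractionalMatching_iff_sum G x
  have hind : ∀ (v : V) (e : G.edgeSet),
      Continuous fun x : G.edgeSet → ℝ => Set.indicator (delta G v) x e := by
    intro v e
    by_cases h : e ∈ delta G v <;> simp only [Set.indicator, h, if_true, if_false] <;> fun_prop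
  have hcl : IsClosed P := by
    rw [hP, Set.ofPred_and, Set.ofPred_forall, Set.ofPred_forall]
    refine (isClosed_iInter fun e => isClosed_le continuous_const (continuous_apply e)).inter
      (isClosed_iInter fun v => isClosed_le (continuous_finsetSum _ fun e _ => hind v e)
        continuous_const)
  have hsub : P ⊆ Set.Icc 0 1 := by
    intro x hx
    rw [hP] at hx
    refine ⟨fun e => hx.1 e, fun e => ?_⟩
    obtain ⟨v, hv⟩ : ∃ v, v ∈ (e : Sym2 V) := ⟨_, Sym2.out_fst_mem _⟩
    refine le_trans ?_ (hx.2 v)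
    have h1 : x e = Set.indicator (delta G v) x e := by
      rw [Set.indicator_of_mem]; exact hv
    rw [h1]
    exact Finset.single_le_sum (f := fun e => Set.indicator (delta G v) x e)
      (fun i _ => Set.indicator_nonneg (fun j _ => hx.1 j) i) (Finset.mem_univ e)
  have hcomp : IsCompact P := isCompact_Icc.of_isClosed_subset hcl hsub
  have hval : ∀ x, value G w x = ∑ e : G.edgeSet, w e * x e := fun x => by
    simp only [value, finsum_eq_sum_of_fintype]
  have hvc : Continuous (value G w) := by
    have : value G w = fun x => ∑ e : G.edgeSet, w e * x e := funext hval
    rw [this]; fun_prop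
  have h0 : (0 : G.edgeSet → ℝ) ∈ P := by rw [hP]; simp
  obtain ⟨x₀, hx₀, hmax⟩ := hcomp.exists_isMaxOn ⟨0, h0⟩ hvc.continuousOn
  let F : Set (G.edgeSet → ℝ) := P ∩ {x | value G w x = value G w x₀}
  have hF : IsCompact F := hcomp.inter_right (isClosed_eq hvc continuous_const)
  obtain ⟨x, hx⟩ := hF.extremePoints_nonempty ⟨x₀, hx₀, rfl⟩
  have hxF : x ∈ F := hx.1
  have hxmax : ∀ x', x' ∈ P → value G w x' ≤ value G w x := by
    intro x' h'
    rw [hxF.2]; exact hmax h'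
  refine ⟨x, ⟨hxF.1, ?_⟩, hxmax⟩
  by_contra hne
  obtain ⟨f, hf0, hf⟩ := Submodule.exists_le_ker_of_lt_top _ (lt_top_iff_ne_top.mpr hne)
  let d : G.edgeSet → ℝ := fun e => f (Pi.single e 1)
  have hfd : ∀ a, f a = ∑ e, a e * d e := by
    intro a
    conv_lhs => rw [pi_eq_sum_univ' a]
    simp [d, map_sum, Pi.single]
  have hxP : (∀ e, 0 ≤ x e) ∧ ∀ v, ∑ e, Set.indicator (delta G v) x e ≤ 1 := by
    have := hxF.1; rw [hP] at this; exact this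
  have hde : ∀ e, x e = 0 → d e = 0 := by
    intro e he
    have h := hf (Submodule.subset_span (Or.inr ⟨e, he, rfl⟩))
    rw [LinearMap.mem_ker, hfd] at h
    simpa [Set.indicator_apply] using h
  have hdv : ∀ v, ∑ e, Set.indicator (delta G v) x e = 1 →
      ∑ e, Set.indicator (delta G v) d e = 0 := by
    intro v hv
    have h := hf (Submodule.subset_span
      (Or.inl ⟨v, by rw [finsum_mem_def, finsum_eq_sum_of_fintype]; exact hv, rfl⟩))
    rw [LinearMap.mem_ker, hfd] at h
    rw [← h]
    refine Finset.sum_congr rfl fun e _ => ?_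
    by_cases he : e ∈ delta G v <;> simp [he]
  have hadd : ∀ (t : ℝ) (v : V), ∑ e, Set.indicator (delta G v) (x + t • d) e =
      ∑ e, Set.indicator (delta G v) x e + t * ∑ e, Set.indicator (delta G v) d e := by
    intro t v
    rw [Finset.mul_sum, ← Finset.sum_add_distrib]
    refine Finset.sum_congr rfl fun e _ => ?_
    by_cases he : e ∈ delta G v <;> simp [he]
  have hev : ∀ᶠ t : ℝ in nhds 0, x + t • d ∈ P := by
    rw [hP]
    refine Filter.Eventually.and ?_ ?_
    · refine Filter.eventually_all.mpr fun e => ?_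
      rcases (hxP.1 e).eq_or_lt with h | h
      · exact Filter.Eventually.of_forall fun t => by simp [← h, hde e h.symm]
      · have hc : Continuous fun t : ℝ => (x + t • d) e := by
          simp only [Pi.add_apply, Pi.smul_apply, smul_eq_mul]; fun_prop
        have := (hc.tendsto 0).eventually_const_lt (u := 0) (by simpa using h)
        exact this.mono fun t ht => ht.le
    · refine Filter.eventually_all.mpr fun v => ?_
      simp only [hadd]
      rcases (hxP.2 v).eq_or_lt with h | h
      · exact Filter.Eventually.of_forall fun t => by rw [hdv v h, h]; simp
      · have hc : Continuous fun t : ℝ => ∑ e, Set.indicator (delta G v) x e +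
            t * ∑ e, Set.indicator (delta G v) d e := by fun_prop
        have := (hc.tendsto 0).eventually_lt_const (u := 1) (by simpa using h)
        exact this.mono fun t ht => ht.le
  have hev' : ∀ᶠ t : ℝ in nhds 0, x + (-t) • d ∈ P := by
    have : Filter.Tendsto (fun t : ℝ => -t) (nhds 0) (nhds 0) := by
      simpa using (continuous_neg (G := ℝ)).tendsto 0
    exact this.eventually hev
  obtain ⟨ε, hε, hball⟩ := Metric.eventually_nhds_iff.mp (hev.and hev')
  obtain ⟨h1, h2⟩ := hball (y := ε / 2) (by
    rw [Real.dist_eq, sub_zero, abs_of_pos (by positivity)]; linarith)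
  have hvadd : ∀ t : ℝ, value G w (x + t • d) = value G w x + t * value G w d := by
    intro t
    rw [hval, hval, hval, Finset.mul_sum, ← Finset.sum_add_distrib]
    refine Finset.sum_congr rfl fun e _ => ?_
    simp only [Pi.add_apply, Pi.smul_apply, smul_eq_mul]; ring
  have e1 := hxmax _ h1
  have e2 := hxmax _ h2
  rw [hvadd] at e1 e2
  have hz : (ε / 2) * value G w d = 0 := by linarith
  have m1 : x + (ε / 2) • d ∈ F := ⟨h1, by
    rw [Set.mem_ofPred_eq, hvadd, hz, add_zero]; exact hxF.2⟩
  have m2 : x + (-(ε / 2)) • d ∈ F := ⟨h2, by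
    rw [Set.mem_ofPred_eq, hvadd, neg_mul, hz, neg_zero, add_zero]; exact hxF.2⟩
  have hseg : x ∈ openSegment ℝ (x + (ε / 2) • d) (x + (-(ε / 2)) • d) :=
    ⟨1 / 2, 1 / 2, by norm_num, by norm_num, by norm_num, by module⟩
  have := hx.2 m1 m2 hseg
  have hd : d = 0 := by
    have h3 : (ε / 2) • d = 0 := by simpa using this
    exact (smul_eq_zero.mp h3).resolve_left (by positivity)
  apply hf0
  ext e
  rw [LinearMap.zero_comp, LinearMap.comp_apply]
  simpa [d] using congrFun hd e

end WGraph

/-! Both claims follow from `gamma_le_gamma_deleteVerts_add`: deleting `S` lowers `γ` by at most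
`|S|`. For a stabilizer, `γ(G ∖ S) = 0`, because a maximum-weight matching is then a basic
maximum-weight fractional matching without entries `1/2` (`gamma_eq_zero_of_isStable`).

The core is `exists_add_vertex`, read in the direction of restoring one vertex `v`. Take a basic
optimal `X'` of the smaller graph and a complementary cover. By Birkhoff's theorem `X'` is `halfMat
σ` for a permutation `σ`: fixed points are exposed, orbits of length two are matching edges, longer
orbits are odd cycles of value `1/2`. Give `v` a large cover value, so that slackness fails only at
`v`, and among all such covers choose one with least value at `v`. Then explore alternating walks of
tight edges from `v`. Each reachable state records a whole matching off the long orbits together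
with its exposed vertex `t`. If `t` has cover value zero, or has a tight edge to an exposed vertex,
to a long orbit or to another reachable vertex, an optimal fractional matching arises (the
`success_of_...` lemmas). If none of this happens, lowering the cover on reachable vertices and
raising it on their tight neighbours contradicts minimality (`success_of_min`).

In every case the support consists of edges of long orbits of `σ`, edges of two matchings elsewhere,
and one extra edge `e`. Pass to a basic solution in this support. A half-valued odd cycle avoiding
`e` cannot lie in the union of two matchings, so it is a cycle of `X'`; half-valued cycles are
edge-disjoint, so at most one contains `e`. Hence the count grows by at most one.

Matrices indexed by all of `V` keep the vertex type fixed while vertices are added; vertices outside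
the current set are merely isolated. -/

namespace WGraph

/-! ### Translation from edge vectors to symmetric matrices. -/

/-- Fractional matchings of `G` as symmetric matrices. -/
structure IsFracMat {V : Type*} [Fintype V] (G : SimpleGraph V) (X : V → V → ℝ) : Prop where
  symm : ∀ a b, X a b = X b a
  nonneg : ∀ a b, 0 ≤ X a b
  adj : ∀ a b, X a b ≠ 0 → G.Adj a b
  row : ∀ a, ∑ b, X a b ≤ 1

/-- The weight of a symmetric matrix; every edge occurs twice in the double sum. -/
noncomputable def matVal {V : Type*} [Fintype V] (w : Sym2 V → ℝ) (X : V → V → ℝ) : ℝ :=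
  (1 / 2) * ∑ a, ∑ b, w s(a, b) * X a b

/-- `X` admits no nonzero perturbation that respects its tight constraints. -/
def IsRigid {V : Type*} [Fintype V] (X : V → V → ℝ) : Prop :=
  ∀ D : V → V → ℝ, (∀ a b, D a b = D b a) → (∀ a b, X a b = 0 → D a b = 0) →
    (∀ a, ∑ b, X a b = 1 → ∑ b, D a b = 0) → D = 0

/-- The edge sets of odd cycles along which `X` is `1/2`. -/
def oddCycleSets {V : Type*} (X : V → V → ℝ) : Set (Set (Sym2 V)) :=
  {C | (∀ a b, s(a, b) ∈ C → X a b = 1 / 2) ∧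
    ∃ (u : V) (p : (⊤ : SimpleGraph V).Walk u u), p.IsCycle ∧ Odd p.length ∧ C = {e | e ∈ p.edges}}

open Classical in
/-- The symmetric matrix of an edge vector. -/
noncomputable def toMat {V : Type*} (G : SimpleGraph V) (x : G.edgeSet → ℝ) (a b : V) : ℝ :=
  if h : G.Adj a b then x ⟨s(a, b), h⟩ else 0

/-- The edge vector of a symmetric matrix. -/
noncomputable def ofMat {V : Type*} (G : SimpleGraph V) (X : V → V → ℝ) (e : G.edgeSet) : ℝ :=
  X (Quot.out (e : Sym2 V)).1 (Quot.out (e : Sym2 V)).2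

section

variable {V : Type*}

lemma toMat_symm (G : SimpleGraph V) (x : G.edgeSet → ℝ) (a b : V) :
    toMat G x a b = toMat G x b a := by
  unfold toMat
  by_cases h : G.Adj a b
  · have h' := h.symm
    simp only [h, h', dif_pos]
    congr 2
    exact Sym2.eq_swap
  · have h' : ¬ G.Adj b a := fun h' => h h'.symm
    simp [h, h']

lemma toMat_mk (G : SimpleGraph V) (x : G.edgeSet → ℝ) {a b : V} (h : G.Adj a b) :
    toMat G x a b = x ⟨s(a, b), h⟩ := by
  simp [toMat, h]

lemma toMat_not_adj (G : SimpleGraph V) (x : G.edgeSet → ℝ) {a b : V} (h : ¬ G.Adj a b) :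
    toMat G x a b = 0 := by
  simp [toMat, h]

/-- `Quot.out` may return either orientation of the edge; symmetry makes the choice harmless. -/
lemma ofMat_mk (G : SimpleGraph V) {X : V → V → ℝ} (hX : ∀ a b, X a b = X b a) {a b : V}
    (h : s(a, b) ∈ G.edgeSet) : ofMat G X ⟨s(a, b), h⟩ = X a b := by
  unfold ofMat
  have h1 : s((Quot.out s(a, b)).1, (Quot.out s(a, b)).2) = s(a, b) := Quot.out_eq _
  rcases Sym2.eq_iff.mp h1 with ⟨h2, h3⟩ | ⟨h2, h3⟩
  · simp only [h2, h3]
  · simp only [h2, h3]; exact hX b a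

lemma toMat_ofMat (G : SimpleGraph V) {X : V → V → ℝ} (hX : ∀ a b, X a b = X b a)
    (hadj : ∀ a b, X a b ≠ 0 → G.Adj a b) : toMat G (ofMat G X) = X := by
  funext a b
  by_cases h : G.Adj a b
  · rw [toMat_mk G _ h]; exact ofMat_mk G hX _
  · rw [toMat_not_adj G _ h]
    by_contra h'
    exact h (hadj a b fun h0 => h' h0.symm)

lemma ofMat_toMat (G : SimpleGraph V) (x : G.edgeSet → ℝ) : ofMat G (toMat G x) = x := by
  funext ⟨e, he⟩
  induction e with
  | _ a b => rw [ofMat_mk G (toMat_symm G x), toMat_mk G x he]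

lemma sum_ite_mk_eq [Fintype V] [DecidableEq V] (a p q : V) (hpq : p ≠ q) :
    ∑ b, (if s(a, b) = s(p, q) then (1 : ℝ) else 0) =
      (if a = p then 1 else 0) + (if a = q then 1 else 0) := by
  by_cases h1 : a = p
  · subst h1
    simp [hpq]
  · by_cases h2 : a = q
    · subst h2
      have : ∀ b, s(a, b) = s(p, a) ↔ b = p := fun b => by
        rw [Sym2.eq_swap (a := p), Sym2.congr_right]
      simp [this, h1]
    · simp [h1, h2]

lemma toMat_eq_sum [Fintype V] [DecidableEq V] (G : SimpleGraph V) [Fintype G.edgeSet]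
    (x : G.edgeSet → ℝ) (a b : V) :
    toMat G x a b = ∑ e : G.edgeSet, x e * (if s(a, b) = (e : Sym2 V) then 1 else 0) := by
  by_cases h : G.Adj a b
  · rw [toMat_mk G x h, Finset.sum_eq_single (⟨s(a, b), h⟩ : G.edgeSet)]
    · simp
    · intro e _ he
      have : ¬ s(a, b) = (e : Sym2 V) := fun h' => he (Subtype.ext h'.symm)
      simp [this]
    · simp
  · rw [toMat_not_adj G x h, Finset.sum_eq_zero]
    rintro ⟨e, he⟩ -
    have : ¬ s(a, b) = e := by rintro rfl; exact h he
    simp [this]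

lemma finsum_delta [Fintype V] (G : SimpleGraph V) (x : G.edgeSet → ℝ) (v : V) :
    ∑ᶠ e ∈ delta G v, x e = ∑ b, toMat G x v b := by
  classical
  simp only [toMat_eq_sum]
  rw [Finset.sum_comm, finsum_mem_def, finsum_eq_sum_of_fintype]
  refine Finset.sum_congr rfl ?_
  rintro ⟨e, he⟩ -
  induction e with
  | _ p q =>
    have hpq : p ≠ q := G.ne_of_adj he
    rw [← Finset.mul_sum, sum_ite_mk_eq v p q hpq]
    by_cases h1 : v = p
    · subst h1; simp [delta, hpq]
    · by_cases h2 : v = q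
      · subst h2; simp [delta, h1]
      · simp [delta, h1, h2]

lemma value_eq_matVal [Fintype V] (G : SimpleGraph V) (w : Sym2 V → ℝ) (x : G.edgeSet → ℝ) :
    value G w x = matVal w (toMat G x) := by
  classical
  unfold value matVal
  have h1 : ∀ a b, w s(a, b) * toMat G x a b =
      ∑ e : G.edgeSet, w e * x e * (if s(a, b) = (e : Sym2 V) then 1 else 0) := by
    intro a b
    rw [toMat_eq_sum, Finset.mul_sum]
    refine Finset.sum_congr rfl fun e _ => ?_
    split_ifs with h
    · rw [h]; ring
    · ring
  simp only [h1]
  rw [finsum_eq_sum_of_fintype]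
  have h2 : ∀ a, ∑ b, ∑ e : G.edgeSet, w e * x e * (if s(a, b) = (e : Sym2 V) then (1 : ℝ) else 0) =
      ∑ e : G.edgeSet, w e * x e * ∑ b, (if s(a, b) = (e : Sym2 V) then (1 : ℝ) else 0) := by
    intro a
    rw [Finset.sum_comm]
    simp only [Finset.mul_sum]
  simp only [h2]
  rw [Finset.sum_comm, Finset.mul_sum]
  refine Finset.sum_congr rfl ?_
  rintro ⟨e, he⟩ -
  induction e with
  | _ p q =>
    have hpq : p ≠ q := G.ne_of_adj he
    rw [← Finset.mul_sum]
    simp only [sum_ite_mk_eq _ p q hpq, Finset.sum_add_distrib, Finset.sum_ite_eq',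
      Finset.mem_univ, if_true]
    ring

lemma isFracMat_toMat [Fintype V] {G : SimpleGraph V} {x : G.edgeSet → ℝ} :
    IsFracMat G (toMat G x) ↔ IsFractionalMatching G x := by
  unfold IsFractionalMatching
  simp only [finsum_delta]
  constructor
  · intro h
    refine ⟨?_, h.row⟩
    rintro ⟨e, he⟩
    induction e with
    | _ p q => rw [← toMat_mk G x he]; exact h.nonneg p q
  · rintro ⟨h1, h2⟩
    refine ⟨toMat_symm G x, ?_, ?_, h2⟩
    · intro a b
      by_cases h : G.Adj a b
      · rw [toMat_mk G x h]; exact h1 _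
      · rw [toMat_not_adj G x h]
    · intro a b h
      by_contra h'
      exact h (toMat_not_adj G x h')

/-- A proper subspace lies in the kernel of a nonzero functional, and functionals on `E → ℝ` are
vectors `d`. -/
lemma span_eq_top_iff {E ι : Type*} [Fintype E] [DecidableEq E] (P : ι → Prop) (A : ι → E → ℝ) :
    Submodule.span ℝ {a | ∃ i, P i ∧ a = A i} = ⊤ ↔
      ∀ d : E → ℝ, (∀ i, P i → ∑ e, A i e * d e = 0) → d = 0 := by
  constructor
  · intro h d hd
    let L : (E → ℝ) →ₗ[ℝ] ℝ := ∑ e, d e • LinearMap.proj e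
    have hL : ∀ a, L a = ∑ e, a e * d e := fun a => by
      simp [L, mul_comm]
    have hle : Submodule.span ℝ {a | ∃ i, P i ∧ a = A i} ≤ LinearMap.ker L := by
      rw [Submodule.span_le]
      rintro _ ⟨i, hi, rfl⟩
      rw [SetLike.mem_coe, LinearMap.mem_ker, hL]
      exact hd i hi
    funext e
    have := hle (h ▸ Submodule.mem_top : Pi.single e (1 : ℝ) ∈ _)
    rw [LinearMap.mem_ker, hL] at this
    simpa [Pi.single_apply] using this
  · intro h
    by_contra hne
    obtain ⟨f, hf0, hf⟩ := Submodule.exists_le_ker_of_lt_top _ (lt_top_iff_ne_top.mpr hne)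
    have hfd : ∀ a, f a = ∑ e, a e * f (Pi.single e 1) := by
      intro a
      conv_lhs => rw [pi_eq_sum_univ' a]
      simp [map_sum, Pi.single]
    have h0 := h (fun e => f (Pi.single e 1)) fun i hi => by
      rw [← hfd]
      exact hf (Submodule.subset_span ⟨i, hi, rfl⟩)
    apply hf0
    ext e
    rw [LinearMap.zero_comp, LinearMap.comp_apply]
    simpa using congrFun h0 e

/-- By `span_eq_top_iff`, the tight constraint vectors span exactly when no nonzero direction is
orthogonal to all of them, which is rigidity of the matrix. -/
lemma isBasic_iff [Fintype V] {G : SimpleGraph V} {x : G.edgeSet → ℝ} :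
    IsBasic G x ↔ IsFracMat G (toMat G x) ∧ IsRigid (toMat G x) := by
  classical
  unfold IsBasic
  rw [isFracMat_toMat]
  refine and_congr_right fun _ => ?_
  have hset : ({a | ∃ v, ∑ᶠ e ∈ delta G v, x e = 1 ∧ a = Set.indicator (delta G v) 1} ∪
        {a | ∃ e, x e = 0 ∧ a = Set.indicator {e} 1} : Set (G.edgeSet → ℝ)) =
      {a | ∃ i : V ⊕ G.edgeSet, Sum.elim (fun v => ∑ b, toMat G x v b = 1) (fun e => x e = 0) i ∧
        a = Sum.elim (fun v => Set.indicator (delta G v) 1) (fun e => Set.indicator {e} 1) i} := by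
    ext a
    simp only [Set.mem_union, Set.mem_ofPred_eq, finsum_delta, Sum.exists, Sum.elim_inl,
      Sum.elim_inr]
  rw [hset, span_eq_top_iff]
  have hdel : ∀ (d : G.edgeSet → ℝ) v,
      ∑ e, Set.indicator (delta G v) (1 : G.edgeSet → ℝ) e * d e = ∑ b, toMat G d v b := by
    intro d v
    rw [← finsum_delta, finsum_mem_def, finsum_eq_sum_of_fintype]
    refine Finset.sum_congr rfl fun e _ => ?_
    by_cases he : e ∈ delta G v <;> simp [he]
  have hsing : ∀ (d : G.edgeSet → ℝ) e',
      ∑ e, Set.indicator {e'} (1 : G.edgeSet → ℝ) e * d e = d e' := by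
    intro d e'
    simp [Set.indicator_apply]
  simp only [Sum.forall, Sum.elim_inl, Sum.elim_inr, hdel, hsing]
  constructor
  · intro h D hD h0 hr
    have hDadj : ∀ a b, D a b ≠ 0 → G.Adj a b := by
      intro a b hab
      by_contra hn
      exact hab (h0 a b (toMat_not_adj G x hn))
    have hDD := toMat_ofMat G hD hDadj
    have := h (ofMat G D) ⟨fun v hv => by rw [hDD]; exact hr v hv, ?_⟩
    · rw [← hDD, this]
      funext a b
      by_cases hab : G.Adj a b
      · rw [toMat_mk G _ hab]; rfl
      · rw [toMat_not_adj G _ hab]; rfl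
    · rintro ⟨e, he⟩ hx
      induction e with
      | _ a b =>
        rw [ofMat_mk G hD]
        exact h0 a b (by rw [toMat_mk G x he, hx])
  · intro h d ⟨h1, h2⟩
    have := h (toMat G d) (toMat_symm G d) ?_ h1
    · rw [← ofMat_toMat G d, this]
      rfl
    · intro a b hab
      by_cases hadj : G.Adj a b
      · rw [toMat_mk G _ hadj] at hab ⊢
        exact h2 _ hab
      · exact toMat_not_adj G d hadj

/-- The value `1/2` forces adjacency, so walks in `⊤` lose nothing. This frees `oddCycleSets` from
the graph and lets matrices over different graphs be compared. -/
lemma oddCycleSets_toMat (G : SimpleGraph V) (x : G.edgeSet → ℝ) :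
    oddCycleSets (toMat G x) = (fun C : Set G.edgeSet => Subtype.val '' C) '' oddCycles G x := by
  ext C
  constructor
  · rintro ⟨hC, u, p, hp, hodd, rfl⟩
    have hadj : ∀ e ∈ p.edges, e ∈ G.edgeSet := by
      intro e he
      induction e with
      | _ a b =>
        by_contra hn
        have := hC a b he
        rw [toMat_not_adj G x hn] at this
        norm_num at this
    have himg : Subtype.val '' {e : G.edgeSet | (e : Sym2 V) ∈ p.edges} = {e | e ∈ p.edges} := by
      ext e
      simp only [Set.mem_image, Set.mem_ofPred_eq, Subtype.exists, exists_and_left, exists_prop]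
      constructor
      · rintro ⟨e', h1, h2, rfl⟩; exact h1
      · intro h; exact ⟨e, h, hadj e h, rfl⟩
    refine ⟨{e | (e : Sym2 V) ∈ p.edges}, ⟨?_, u, p.transfer G hadj, hp.transfer hadj, ?_, ?_⟩, himg⟩
    · rintro ⟨e, he⟩ hep
      induction e with
      | _ a b => rw [← toMat_mk G x he]; exact hC a b hep
    · rwa [SimpleGraph.Walk.length_transfer]
    · rw [SimpleGraph.Walk.edges_transfer]; exact himg
  · rintro ⟨C, ⟨hC, u, p, hp, hodd, hCp⟩, rfl⟩
    refine ⟨?_, u, p.mapLe le_top, hp.mapLe le_top, ?_, ?_⟩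
    · rintro a b ⟨⟨e, he⟩, h1, h2⟩
      simp only at h2
      subst h2
      rw [toMat_mk G x he]
      exact hC _ h1
    · rwa [SimpleGraph.Walk.mapLe, SimpleGraph.Walk.length_map]
    · rw [SimpleGraph.Walk.edges_mapLe_eq_edges]; exact hCp

lemma ncard_oddCycleSets_toMat (G : SimpleGraph V) (x : G.edgeSet → ℝ) :
    (oddCycleSets (toMat G x)).ncard = (oddCycles G x).ncard := by
  rw [oddCycleSets_toMat, Set.ncard_image_of_injective]
  exact Set.image_injective.mpr Subtype.val_injective

/-- Basic maximum-weight fractional matchings as matrices. -/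
structure IsOptMat [Fintype V] (G : SimpleGraph V) (w : Sym2 V → ℝ) (X : V → V → ℝ) : Prop where
  frac : IsFracMat G X
  rigid : IsRigid X
  max : ∀ Y, IsFracMat G Y → matVal w Y ≤ matVal w X

lemma isOptMat_toMat [Fintype V] {G : SimpleGraph V} {w : Sym2 V → ℝ} {x : G.edgeSet → ℝ} :
    IsOptMat G w (toMat G x) ↔ IsBasicMax G w x := by
  unfold IsBasicMax
  rw [isBasic_iff]
  constructor
  · rintro ⟨h1, h2, h3⟩
    refine ⟨⟨h1, h2⟩, fun x' hx' => ?_⟩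
    rw [value_eq_matVal, value_eq_matVal]
    exact h3 _ (isFracMat_toMat.mpr hx')
  · rintro ⟨⟨h1, h2⟩, h3⟩
    refine ⟨h1, h2, fun Y hY => ?_⟩
    have hYY := toMat_ofMat G hY.symm hY.adj
    rw [← hYY, ← value_eq_matVal, ← value_eq_matVal]
    exact h3 _ (isFracMat_toMat.mp (by rwa [hYY]))

lemma exists_isOptMat_ncard_eq_gamma [Fintype V] (G : SimpleGraph V) (w : Sym2 V → ℝ) :
    ∃ X, IsOptMat G w X ∧ (oddCycleSets X).ncard = gamma G w := by
  obtain ⟨x₀, hx₀⟩ := exists_isBasicMax G w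
  have hne : {k | ∃ x, IsBasicMax G w x ∧ k = (oddCycles G x).ncard}.Nonempty :=
    ⟨_, x₀, hx₀, rfl⟩
  obtain ⟨x, hx, hk⟩ := Nat.sInf_mem hne
  exact ⟨toMat G x, isOptMat_toMat.mpr hx, by rw [ncard_oddCycleSets_toMat, ← hk]; rfl⟩

lemma gamma_le_ncard [Fintype V] {G : SimpleGraph V} {w : Sym2 V → ℝ} {X : V → V → ℝ}
    (hX : IsOptMat G w X) : gamma G w ≤ (oddCycleSets X).ncard := by
  have hXX := toMat_ofMat G hX.frac.symm hX.frac.adj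
  refine Nat.sInf_le ⟨ofMat G X, isOptMat_toMat.mp (by rwa [hXX]), ?_⟩
  rw [← ncard_oddCycleSets_toMat, hXX]

end

end WGraph

/-! ### Half-integrality: rigid matrices come from permutations. -/

namespace WGraph

open Function

/-- The fractional matching of a permutation `σ`: half the sum of the edges `{a, σ a}`. -/
noncomputable def halfMat {V : Type*} [DecidableEq V] (σ : Equiv.Perm V) (a b : V) : ℝ :=
  if a = b then 0 else ((if σ a = b then 1 else 0) + (if σ b = a then 1 else 0)) / 2

/-- The alternating sum of the edges of the sequence `p 0, …, p n`. -/
noncomputable def altMat {V : Type*} [DecidableEq V] (p : ℕ → V) (n : ℕ) (c d : V) : ℝ :=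
  ∑ j ∈ Finset.range n, (-1 : ℝ) ^ j * (if s(c, d) = s(p j, p (j + 1)) then 1 else 0)

section

variable {V : Type*}

lemma three_le_minimalPeriod [Finite V] {σ : Equiv.Perm V} {a : V} (ha : σ (σ a) ≠ a) :
    3 ≤ minimalPeriod σ a := by
  have hper : a ∈ periodicPts σ := by
    refine ⟨orderOf σ, orderOf_pos σ, ?_⟩
    change σ^[orderOf σ] a = a
    rw [← Equiv.Perm.coe_pow, pow_orderOf_eq_one]
    rfl
  have h0 := minimalPeriod_pos_of_mem_periodicPts hper
  have hit : σ^[minimalPeriod σ a] a = a := iterate_minimalPeriod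
  by_contra! hlt
  interval_cases h : minimalPeriod σ a
  · simp at hit
    exact ha (by rw [hit, hit])
  · exact ha hit

lemma iterate_ne_succ {σ : Equiv.Perm V} {a : V} (ha : σ a ≠ a) (j : ℕ) :
    σ^[j] a ≠ σ^[j + 1] a := by
  rw [iterate_succ_apply]
  exact fun h => ha (σ.injective.iterate j h).symm

lemma iterate_sq_ne {σ : Equiv.Perm V} {a : V} (ha : σ (σ a) ≠ a) (j : ℕ) :
    σ (σ (σ^[j] a)) ≠ σ^[j] a := by
  rw [← iterate_succ_apply' σ, ← iterate_succ_apply' σ, iterate_succ_apply, iterate_succ_apply]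
  exact fun h => ha (σ.injective.iterate j h)

/-- The edges along an orbit of length at least three are distinct. -/
lemma orbit_edge_injective {σ : Equiv.Perm V} {a : V} (ha : 3 ≤ minimalPeriod σ a) {i j : ℕ}
    (hi : i < minimalPeriod σ a) (hj : j < minimalPeriod σ a)
    (h : s(σ^[i] a, σ^[i + 1] a) = s(σ^[j] a, σ^[j + 1] a)) : i = j := by
  rcases Sym2.eq_iff.mp h with ⟨h1, -⟩ | ⟨h1, h2⟩
  · exact iterate_injOn_Iio_minimalPeriod hi hj h1
  -- Edges traversed in opposite directions would give a point of the orbit fixed by `σ²`, so the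
  -- period would divide 2.
  · exfalso
    have h3 : IsPeriodicPt σ 2 (σ^[i] a) := by
      change σ^[2] (σ^[i] a) = σ^[i] a
      change σ (σ (σ^[i] a)) = σ^[i] a
      rw [← iterate_succ_apply' σ i, h2, ← iterate_succ_apply' σ j, h1]
    have h4 := h3.minimalPeriod_dvd
    have hper : a ∈ periodicPts σ := by
      rw [← minimalPeriod_pos_iff_mem_periodicPts]; omega
    rw [minimalPeriod_apply_iterate hper] at h4
    have := Nat.le_of_dvd (by norm_num) h4
    omega

variable [DecidableEq V]

lemma halfMat_symm (σ : Equiv.Perm V) (a b : V) : halfMat σ a b = halfMat σ b a := by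
  unfold halfMat
  by_cases h : a = b
  · subst h; rfl
  · rw [if_neg h, if_neg (Ne.symm h), add_comm]

lemma halfMat_nonneg (σ : Equiv.Perm V) (a b : V) : 0 ≤ halfMat σ a b := by
  unfold halfMat
  split_ifs <;> norm_num

lemma halfMat_row [Fintype V] (σ : Equiv.Perm V) (a : V) :
    ∑ b, halfMat σ a b = if σ a = a then 0 else 1 := by
  split_ifs with h
  · refine Finset.sum_eq_zero fun b _ => ?_
    unfold halfMat
    by_cases hab : a = b
    · simp [hab]
    · have h2 : σ b ≠ a := fun h2 => hab (σ.injective (h.trans h2.symm))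
      simp [hab, h, h2]
  · have h1 : ∀ b, halfMat σ a b =
        (if b = σ a then 1 / 2 else 0) + (if b = σ⁻¹ a then 1 / 2 else 0) := by
      intro b
      have e1 : b = σ⁻¹ a ↔ σ b = a := by rw [Equiv.Perm.eq_inv_iff_eq]
      have e2 : b = σ a ↔ σ a = b := eq_comm
      simp only [e1, e2]
      unfold halfMat
      by_cases hab : a = b
      · subst hab; simp [h]
      · rw [if_neg hab]
        split_ifs <;> norm_num
    simp only [h1, Finset.sum_add_distrib, Finset.sum_ite_eq', Finset.mem_univ, if_true]
    norm_num

/-- Rigid fractional matchings are half-integral, by Birkhoff's theorem. -/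
lemma exists_eq_halfMat [Fintype V] {G : SimpleGraph V} {X : V → V → ℝ} (hX : IsFracMat G X)
    (hr : IsRigid X) : ∃ σ : Equiv.Perm V, X = halfMat σ := by
  have hdiag : ∀ a, X a a = 0 := fun a => by
    by_contra h
    exact G.loopless.irrefl a (hX.adj a a h)
  -- Placing the slack of each row on the diagonal makes the matrix doubly stochastic.
  let M : Matrix V V ℝ := fun a b => if a = b then 1 - ∑ c, X a c else X a b
  have hMrow : ∀ a, ∑ b, M a b = 1 := by
    intro a
    have : ∀ b, M a b = X a b + if a = b then 1 - ∑ c, X a c else 0 := by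
      intro b
      by_cases h : a = b
      · subst h; simp [M, hdiag]
      · simp [M, h]
    simp only [this, Finset.sum_add_distrib, Finset.sum_ite_eq, Finset.mem_univ, if_true]
    ring
  have hMsymm : ∀ a b, M a b = M b a := by
    intro a b
    by_cases h : a = b
    · subst h; rfl
    · simp only [M, if_neg h, if_neg (Ne.symm h)]
      exact hX.symm a b
  have hM : M ∈ doublyStochastic ℝ V := by
    rw [mem_doublyStochastic_iff_sum]
    refine ⟨fun a b => ?_, hMrow, fun b => ?_⟩
    · by_cases h : a = b
      · simp only [M, if_pos h]; linarith [hX.row a]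
      · simp only [M, if_neg h]; exact hX.nonneg a b
    · rw [← hMrow b]
      exact Finset.sum_congr rfl fun a _ => hMsymm a b
  obtain ⟨l, hl0, hl1, hl⟩ := exists_eq_sum_perm_of_mem_doublyStochastic hM
  obtain ⟨σ, hσ⟩ : ∃ σ, 0 < l σ := by
    by_contra! h
    have : ∑ σ, l σ ≤ 0 := Finset.sum_nonpos fun σ _ => h σ
    linarith
  -- The convex combination has nonnegative terms, so a permutation of positive weight lives on the
  -- support of `M`.
  have hzero : ∀ a b, M a b = 0 → σ a ≠ b := by
    intro a b hab hσab
    rw [← hl, Matrix.sum_apply] at hab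
    have h1 := (Finset.sum_eq_zero_iff_of_nonneg (fun τ _ => by
      rw [Matrix.smul_apply, smul_eq_mul]
      refine mul_nonneg (hl0 τ) ?_
      rw [Equiv.Perm.permMatrix, PEquiv.toMatrix_apply]
      split_ifs <;> norm_num)).mp hab σ (Finset.mem_univ σ)
    rw [Matrix.smul_apply, smul_eq_mul, Equiv.Perm.permMatrix, PEquiv.toMatrix_apply] at h1
    simp [hσab] at h1
    exact hσ.ne' h1
  refine ⟨σ, ?_⟩
  -- A tight row has diagonal entry zero in `M`, so `σ` moves its index and the row of `halfMat σ`
  -- also sums to 1. The difference thus respects all tight constraints and rigidity kills it.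
  have hD := hr (fun a b => X a b - halfMat σ a b) ?_ ?_ ?_
  · funext a b
    have := congrFun (congrFun hD a) b
    simp only [Pi.zero_apply] at this
    linarith
  · intro a b
    simp only [hX.symm a b, halfMat_symm σ a b]
  · intro a b hab
    simp only [hab]
    unfold halfMat
    by_cases h : a = b
    · simp [h]
    · have h1 : σ a ≠ b := hzero a b (by simp only [M, if_neg h]; exact hab)
      have h2 : σ b ≠ a := hzero b a (by
        simp only [M, if_neg (Ne.symm h)]; rw [hX.symm]; exact hab)
      simp [h, h1, h2]
  · intro a ha
    have h1 : σ a ≠ a := hzero a a (by simp [M, ha])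
    rw [Finset.sum_sub_distrib, ha, halfMat_row, if_neg h1, sub_self]

lemma altMat_symm (p : ℕ → V) (n : ℕ) (c d : V) : altMat p n c d = altMat p n d c := by
  unfold altMat
  rw [Sym2.eq_swap]

/-- Consecutive edges cancel at their common vertex, so only the two ends survive. For a closed
sequence they cancel if `n` is even and add up to 2 if `n` is odd. -/
lemma altMat_row [Fintype V] (p : ℕ → V) (hp : ∀ j, p j ≠ p (j + 1)) (n : ℕ) (c : V) :
    ∑ d, altMat p n c d = (if c = p 0 then 1 else 0) - (-1) ^ n * (if c = p n then 1 else 0) := by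
  unfold altMat
  rw [Finset.sum_comm]
  simp only [← Finset.mul_sum]
  induction n with
  | zero => simp
  | succ n ih =>
    rw [Finset.sum_range_succ, ih, sum_ite_mk_eq c _ _ (hp n), pow_succ]
    ring

lemma exists_of_altMat_ne_zero {p : ℕ → V} {n : ℕ} {c d : V} (h : altMat p n c d ≠ 0) :
    ∃ j < n, s(c, d) = s(p j, p (j + 1)) := by
  obtain ⟨j, hj, hne⟩ := Finset.exists_ne_zero_of_sum_ne_zero h
  refine ⟨j, Finset.mem_range.mp hj, ?_⟩
  by_contra hn
  simp [hn] at hne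

lemma altMat_orbit {σ : Equiv.Perm V} {a : V} (ha : 3 ≤ minimalPeriod σ a) {i : ℕ}
    (hi : i < minimalPeriod σ a) {c d : V} (h : s(c, d) = s(σ^[i] a, σ^[i + 1] a)) :
    altMat (fun j => σ^[j] a) (minimalPeriod σ a) c d = (-1) ^ i := by
  unfold altMat
  rw [Finset.sum_eq_single i]
  · simp [h]
  · intro j hj hji
    rw [if_neg, mul_zero]
    intro h'
    exact hji (orbit_edge_injective ha (Finset.mem_range.mp hj) hi (h'.symm.trans h))
  · intro h'
    exact absurd (Finset.mem_range.mpr hi) h'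

lemma abs_altMat_orbit_le {σ : Equiv.Perm V} {a : V} (ha : 3 ≤ minimalPeriod σ a) (c d : V) :
    |altMat (fun j => σ^[j] a) (minimalPeriod σ a) c d| ≤ 1 := by
  by_cases h : altMat (fun j => σ^[j] a) (minimalPeriod σ a) c d = 0
  · rw [h]; norm_num
  · obtain ⟨j, hj, hcd⟩ := exists_of_altMat_ne_zero h
    rw [altMat_orbit ha hj hcd, abs_pow, abs_neg, abs_one, one_pow]

lemma halfMat_eq_half {σ : Equiv.Perm V} {a : V} (ha : σ (σ a) ≠ a) :
    halfMat σ a (σ a) = 1 / 2 := by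
  have h1 : a ≠ σ a := fun h => ha (by rw [← h, ← h])
  simp [halfMat, h1, ha]

/-- Orbits carrying the value `1/2` of a rigid fractional matching are odd. -/
lemma odd_minimalPeriod [Fintype V] {σ : Equiv.Perm V} (hr : IsRigid (halfMat σ)) {a : V}
    (ha : σ (σ a) ≠ a) : Odd (minimalPeriod σ a) := by
  by_contra hn
  rw [Nat.not_odd_iff_even] at hn
  have h3 := three_le_minimalPeriod ha
  have ha1 : σ a ≠ a := fun h => ha (by rw [h, h])
  -- Along an even orbit the alternating sum has zero row sums, a nonzero perturbation that rigidity
  -- forbids.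
  have hD := hr (altMat (fun j => σ^[j] a) (minimalPeriod σ a)) (altMat_symm _ _) ?_ ?_
  · have h1 : altMat (fun j => σ^[j] a) (minimalPeriod σ a) a (σ a) = (-1) ^ 0 :=
      altMat_orbit h3 (by omega) (by simp)
    rw [hD] at h1
    simp at h1
  · intro c d hcd
    by_contra hne
    obtain ⟨j, hj, h⟩ := exists_of_altMat_ne_zero hne
    have hval : halfMat σ (σ^[j] a) (σ^[j + 1] a) = 1 / 2 := by
      rw [iterate_succ_apply']
      exact halfMat_eq_half (iterate_sq_ne ha j)
    rcases Sym2.eq_iff.mp h with ⟨rfl, rfl⟩ | ⟨rfl, rfl⟩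
    · rw [hval] at hcd; norm_num at hcd
    · rw [halfMat_symm, hval] at hcd; norm_num at hcd
  · intro c _
    rw [altMat_row _ (iterate_ne_succ ha1), hn.neg_one_pow, iterate_minimalPeriod, one_mul]
    exact sub_self _

end

end WGraph

/-! ### Odd cycles of value `1/2`. -/

namespace WGraph

section

variable {V : Type*}

lemma exists_two_edges {G : SimpleGraph V} {u : V} {p : G.Walk u u} (hp : p.IsCycle) {a : V}
    (ha : a ∈ p.support) : ∃ b c, b ≠ c ∧ s(a, b) ∈ p.edges ∧ s(a, c) ∈ p.edges := by
  obtain ⟨b, c, hbc, h⟩ := Set.ncard_eq_two.mp (hp.ncard_neighborSet_toSubgraph_eq_two ha)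
  refine ⟨b, c, hbc, ?_, ?_⟩
  · rw [← SimpleGraph.Walk.adj_toSubgraph_iff_mem_edges, ← SimpleGraph.Subgraph.mem_neighborSet, h]
    simp
  · rw [← SimpleGraph.Walk.adj_toSubgraph_iff_mem_edges, ← SimpleGraph.Subgraph.mem_neighborSet, h]
    simp

/-- The hypothesis covers both orientations of each edge, so `P` is constant along the walk. It
serves as connectedness of a cycle. -/
lemma walk_invariant {G : SimpleGraph V} {u v : V} (p : G.Walk u v) (P : V → Prop)
    (hP : ∀ a b, s(a, b) ∈ p.edges → P a → P b) {a b : V} (ha : a ∈ p.support) (hPa : P a)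
    (hb : b ∈ p.support) : P b := by
  have key : ∀ c ∈ p.support, (P u ↔ P c) := by
    clear ha hb
    induction p with
    | nil => intro c hc; simp at hc; rw [hc]
    | @cons u v' w h q ih =>
      intro c hc
      rw [SimpleGraph.Walk.support_cons, List.mem_cons] at hc
      rcases hc with rfl | hc
      · rfl
      · have h1 := ih (fun a b hab => hP a b (by simp [hab])) c hc
        rw [← h1]
        exact ⟨hP u v' (by simp), hP v' u (by simp [Sym2.eq_swap])⟩
  exact (key b hb).mp ((key a ha).mpr hPa)

lemma eq_or_eq_of_half [Fintype V] {G : SimpleGraph V} {X : V → V → ℝ} (hX : IsFracMat G X)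
    {a b c d : V} (hbc : b ≠ c) (hb : X a b = 1 / 2) (hc : X a c = 1 / 2) (hd : X a d = 1 / 2) :
    d = b ∨ d = c := by
  classical
  by_contra! h
  have h1 : ∑ e ∈ {b, c, d}, X a e ≤ ∑ e, X a e :=
    Finset.sum_le_sum_of_subset_of_nonneg (Finset.subset_univ _) fun e _ _ => hX.nonneg a e
  rw [Finset.sum_insert (by simp [hbc, h.1.symm]), Finset.sum_insert (by simp [h.2.symm]),
    Finset.sum_singleton, hb, hc, hd] at h1
  have := hX.row a
  linarith

/-- The cycle already contains two half-edges at each of its vertices, and a third would exceed the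
row bound 1. -/
lemma half_edge_mem [Fintype V] {G H : SimpleGraph V} {X : V → V → ℝ} (hX : IsFracMat G X)
    {u : V} {p : H.Walk u u} (hp : p.IsCycle) (hC : ∀ a b, s(a, b) ∈ p.edges → X a b = 1 / 2)
    {a b : V} (ha : a ∈ p.support) (hab : X a b = 1 / 2) : s(a, b) ∈ p.edges := by
  obtain ⟨c, d, hcd, hc, hd⟩ := exists_two_edges hp ha
  rcases eq_or_eq_of_half hX hcd (hC a c hc) (hC a d hd) hab with rfl | rfl
  · exact hc
  · exact hd

/-- Odd cycles of value `1/2` that share an edge coincide. -/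
lemma oddCycleSets_eq_of_mem [Fintype V] {G : SimpleGraph V} {X : V → V → ℝ} (hX : IsFracMat G X)
    {C₁ C₂ : Set (Sym2 V)} (h₁ : C₁ ∈ oddCycleSets X) (h₂ : C₂ ∈ oddCycleSets X) {e : Sym2 V}
    (he₁ : e ∈ C₁) (he₂ : e ∈ C₂) : C₁ = C₂ := by
  have key : ∀ {C₁ C₂ : Set (Sym2 V)}, C₁ ∈ oddCycleSets X → C₂ ∈ oddCycleSets X →
      e ∈ C₁ → e ∈ C₂ → C₁ ⊆ C₂ := by
    rintro _ _ ⟨hC, u, p, hp, -, rfl⟩ ⟨hD, v, q, hq, -, rfl⟩ h1 h2 e' he'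
    induction e with
    | _ a b =>
    induction e' with
    | _ c d =>
      have hinv := walk_invariant p (fun z => z ∈ q.support) (fun x y hxy hx =>
        q.snd_mem_support_of_mem_edges (half_edge_mem hX hq hD hx (hC x y hxy)))
        (p.fst_mem_support_of_mem_edges h1) (q.fst_mem_support_of_mem_edges h2)
        (p.fst_mem_support_of_mem_edges he')
      exact half_edge_mem hX hq hD hinv (hC c d he')
  exact (key h₁ h₂ he₁ he₂).antisymm (key h₂ h₁ he₂ he₁)

/-- Half-valued odd cycles sharing an edge coincide, so only one of them can contain `e`. -/
lemma ncard_oddCycleSets_le [Fintype V] {G : SimpleGraph V} {X Y : V → V → ℝ}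
    (hX : IsFracMat G X) (e : Sym2 V)
    (h : ∀ C ∈ oddCycleSets X, e ∉ C → C ∈ oddCycleSets Y) :
    (oddCycleSets X).ncard ≤ (oddCycleSets Y).ncard + 1 := by
  have hsub : oddCycleSets X ⊆ oddCycleSets Y ∪ {C | C ∈ oddCycleSets X ∧ e ∈ C} := by
    intro C hC
    by_cases he : e ∈ C
    · exact Or.inr ⟨hC, he⟩
    · exact Or.inl (h C hC he)
  have h1 : {C | C ∈ oddCycleSets X ∧ e ∈ C}.ncard ≤ 1 :=
    (Set.ncard_le_one (Set.toFinite _)).mpr fun C₁ h₁ C₂ h₂ =>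
      oddCycleSets_eq_of_mem hX h₁.1 h₂.1 h₁.2 h₂.2
  calc (oddCycleSets X).ncard ≤ _ := Set.ncard_le_ncard hsub (Set.toFinite _)
    _ ≤ _ := Set.ncard_union_le _ _
    _ ≤ _ := by omega

lemma card_support_of_isCycle [DecidableEq V] {G : SimpleGraph V} {u : V} {p : G.Walk u u}
    (hp : p.IsCycle) : p.support.toFinset.card = p.length := by
  have h1 : p.support.toFinset = p.support.tail.toFinset := by
    ext a
    rw [List.mem_toFinset, List.mem_toFinset, SimpleGraph.Walk.mem_support_iff]
    constructor
    · rintro (rfl | h)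
      · exact SimpleGraph.Walk.end_mem_tail_support hp.not_nil
      · exact h
    · exact Or.inr
  rw [h1, List.toFinset_card_of_nodup hp.support_nodup]
  simp

/-- The union of two matchings contains no odd cycle. -/
lemma not_odd_of_involutive {G : SimpleGraph V} {u : V} {p : G.Walk u u}
    (hp : p.IsCycle) {f g : V → V} (hf : Function.Involutive f)
    (h : ∀ a b, s(a, b) ∈ p.edges → f a = b ∨ g a = b) : ¬ Odd p.length := by
  classical
  -- Of the two distinct cycle neighbours of `a` at most one is `g a`, so the other is `f a`. Thus
  -- `f` pairs off the vertices of the cycle, and their number is even.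
  have hmem : ∀ a ∈ p.support, f a ≠ a ∧ f a ∈ p.support := by
    intro a ha
    obtain ⟨b, c, hbc, hb, hc⟩ := exists_two_edges hp ha
    have hfe : s(a, f a) ∈ p.edges := by
      rcases h a b hb with h1 | h1
      · rwa [h1]
      · rcases h a c hc with h2 | h2
        · rwa [h2]
        · exact absurd (h1.symm.trans h2) hbc
    exact ⟨fun h0 => G.ne_of_adj (p.adj_of_mem_edges hfe) h0.symm,
      p.snd_mem_support_of_mem_edges hfe⟩
  have hsum : ∑ a ∈ p.support.toFinset, (1 : ZMod 2) = 0 :=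
    Finset.sum_involution (fun a _ => f a) (fun _ _ => by decide)
      (fun a ha _ => (hmem a (List.mem_toFinset.mp ha)).1)
      (fun a ha => List.mem_toFinset.mpr (hmem a (List.mem_toFinset.mp ha)).2)
      (fun a _ => hf a)
  rw [Finset.sum_const, card_support_of_isCycle hp, nsmul_eq_mul, mul_one,
    ZMod.natCast_eq_zero_iff_even] at hsum
  exact Nat.not_odd_iff_even.mpr hsum

/-- An edge failing `Y a b = 1 / 2` lies off `W`. By connectedness the whole cycle then lies off
`W`, an odd cycle in the union of `f` and `g`. -/
lemma mem_oddCycleSets_of_subset {X Y : V → V → ℝ} {W : Set V} {f g : V → V}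
    (hf : Function.Involutive f) {C : Set (Sym2 V)} (hC : C ∈ oddCycleSets X)
    (h : ∀ a b, s(a, b) ∈ C → (a ∈ W ∧ b ∈ W ∧ Y a b = 1 / 2) ∨
      (a ∉ W ∧ b ∉ W ∧ (f a = b ∨ g a = b))) : C ∈ oddCycleSets Y := by
  obtain ⟨-, u, p, hp, hodd, rfl⟩ := hC
  refine ⟨fun a b hab => ?_, u, p, hp, hodd, rfl⟩
  by_contra hne
  have ha : a ∉ W := by
    rcases h a b hab with h1 | h1
    · exact absurd h1.2.2 hne
    · exact h1.1
  have hinv : ∀ c ∈ p.support, c ∉ W := fun c hc =>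
    walk_invariant p (· ∉ W) (fun x y hxy hx => by
      rcases h x y hxy with h1 | h1
      · exact absurd h1.1 hx
      · exact h1.2.1) (p.fst_mem_support_of_mem_edges hab) ha hc
  refine not_odd_of_involutive hp hf (g := g) (fun x y hxy => ?_) hodd
  rcases h x y hxy with h1 | h1
  · exact absurd h1.1 (hinv x (p.fst_mem_support_of_mem_edges hxy))
  · exact h1.2.2

end

end WGraph

/-! ### Linear programming duality and complementary slackness. -/

namespace WGraph

/-- Fractional `w`-vertex covers. -/
structure IsCover {V : Type*} (G : SimpleGraph V) (w : Sym2 V → ℝ) (y : V → ℝ) : Prop where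
  nonneg : ∀ a, 0 ≤ y a
  edge : ∀ a b, G.Adj a b → w s(a, b) ≤ y a + y b

/-- Complementary slackness. -/
structure IsComplementary {V : Type*} [Fintype V] (w : Sym2 V → ℝ) (X : V → V → ℝ) (y : V → ℝ) :
    Prop where
  tight : ∀ a b, X a b ≠ 0 → w s(a, b) = y a + y b
  sat : ∀ a, 0 < y a → ∑ b, X a b = 1

/-- Vertex covers that satisfy complementary slackness with `X` except at the vertex `v`. -/
structure IsPartialCover {V : Type*} [Fintype V] (G : SimpleGraph V) (w : Sym2 V → ℝ)
    (X : V → V → ℝ) (v : V) (y : V → ℝ) : Prop where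
  cover : IsCover G w y
  tight : ∀ a b, X a b ≠ 0 → w s(a, b) = y a + y b
  sat : ∀ a, a ≠ v → ∑ b, X a b ≠ 1 → y a = 0

section

variable {V : Type*} [Fintype V]

/-- The gap is written as a sum of products of a constraint slack with its dual variable. For
feasible pairs all terms are nonnegative: this gives weak duality, and equality exactly under
complementary slackness. -/
lemma duality_gap {w : Sym2 V → ℝ} {X : V → V → ℝ} (hX : ∀ a b, X a b = X b a) (y : V → ℝ) :
    ∑ a, y a - matVal w X = (1 / 2) * ∑ a, ∑ b, (y a + y b - w s(a, b)) * X a b +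
      ∑ a, y a * (1 - ∑ b, X a b) := by
  have h1 : ∑ a, ∑ b, y b * X a b = ∑ a, ∑ b, y a * X a b := by
    rw [Finset.sum_comm]
    exact Finset.sum_congr rfl fun a _ => Finset.sum_congr rfl fun b _ => by rw [hX]
  unfold matVal
  simp only [sub_mul, add_mul, Finset.sum_sub_distrib, Finset.sum_add_distrib, mul_sub, mul_one,
    Finset.mul_sum] at h1 ⊢
  simp only [← Finset.mul_sum] at h1 ⊢
  rw [h1]
  ring

lemma matVal_le_sum {G : SimpleGraph V} {w : Sym2 V → ℝ} {X : V → V → ℝ} {y : V → ℝ}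
    (hX : IsFracMat G X) (hy : IsCover G w y) : matVal w X ≤ ∑ a, y a := by
  have h := duality_gap (w := w) hX.symm y
  have h1 : 0 ≤ ∑ a, ∑ b, (y a + y b - w s(a, b)) * X a b :=
    Finset.sum_nonneg fun a _ => Finset.sum_nonneg fun b _ => by
      by_cases h0 : X a b = 0
      · simp [h0]
      · exact mul_nonneg (sub_nonneg.mpr (hy.edge a b (hX.adj a b h0))) (hX.nonneg a b)
  have h2 : 0 ≤ ∑ a, y a * (1 - ∑ b, X a b) :=
    Finset.sum_nonneg fun a _ => mul_nonneg (hy.nonneg a) (sub_nonneg.mpr (hX.row a))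
  linarith

lemma matVal_eq_sum_iff {G : SimpleGraph V} {w : Sym2 V → ℝ} {X : V → V → ℝ} {y : V → ℝ}
    (hX : IsFracMat G X) (hy : IsCover G w y) : matVal w X = ∑ a, y a ↔ IsComplementary w X y := by
  have h := duality_gap (w := w) hX.symm y
  have h0 : ∀ a b, 0 ≤ (y a + y b - w s(a, b)) * X a b := fun a b => by
    by_cases h0 : X a b = 0
    · simp [h0]
    · exact mul_nonneg (sub_nonneg.mpr (hy.edge a b (hX.adj a b h0))) (hX.nonneg a b)
  have h0' : ∀ a, 0 ≤ y a * (1 - ∑ b, X a b) :=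
    fun a => mul_nonneg (hy.nonneg a) (sub_nonneg.mpr (hX.row a))
  have h1 : 0 ≤ ∑ a, ∑ b, (y a + y b - w s(a, b)) * X a b :=
    Finset.sum_nonneg fun a _ => Finset.sum_nonneg fun b _ => h0 a b
  have h2 : 0 ≤ ∑ a, y a * (1 - ∑ b, X a b) := Finset.sum_nonneg fun a _ => h0' a
  constructor
  · intro he
    have e1 : ∑ a, ∑ b, (y a + y b - w s(a, b)) * X a b = 0 := by linarith
    have e2 : ∑ a, y a * (1 - ∑ b, X a b) = 0 := by linarith
    refine ⟨fun a b hab => ?_, fun a ha => ?_⟩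
    · have e3 := (Finset.sum_eq_zero_iff_of_nonneg
        (fun a _ => Finset.sum_nonneg fun b _ => h0 a b)).mp e1 a (Finset.mem_univ a)
      have e4 := (Finset.sum_eq_zero_iff_of_nonneg (fun b _ => h0 a b)).mp e3 b (Finset.mem_univ b)
      rcases mul_eq_zero.mp e4 with e5 | e5
      · linarith
      · exact absurd e5 hab
    · have e3 := (Finset.sum_eq_zero_iff_of_nonneg (fun a _ => h0' a)).mp e2 a (Finset.mem_univ a)
      rcases mul_eq_zero.mp e3 with e5 | e5
      · linarith
      · linarith
  · intro hc
    have e1 : ∑ a, ∑ b, (y a + y b - w s(a, b)) * X a b = 0 :=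
      Finset.sum_eq_zero fun a _ => Finset.sum_eq_zero fun b _ => by
        by_cases h0 : X a b = 0
        · simp [h0]
        · rw [hc.tight a b h0]; ring
    have e2 : ∑ a, y a * (1 - ∑ b, X a b) = 0 := Finset.sum_eq_zero fun a _ => by
      rcases (hy.nonneg a).eq_or_lt with h3 | h3
      · simp [← h3]
      · rw [hc.sat a h3]; ring
    linarith

lemma max_of_isCompl {G : SimpleGraph V} {w : Sym2 V → ℝ} {X : V → V → ℝ} {y : V → ℝ}
    (hX : IsFracMat G X) (hy : IsCover G w y) (hc : IsComplementary w X y) (Y : V → V → ℝ)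
    (hY : IsFracMat G Y) : matVal w Y ≤ matVal w X := by
  rw [(matVal_eq_sum_iff hX hy).mpr hc]
  exact matVal_le_sum hY hy

lemma isCompl_of_le {G : SimpleGraph V} {w : Sym2 V → ℝ} {X X₀ : V → V → ℝ} {y : V → ℝ}
    (hX₀ : IsFracMat G X₀) (hy : IsCover G w y) (hc : IsComplementary w X₀ y) (hX : IsFracMat G X)
    (hle : matVal w X₀ ≤ matVal w X) : IsComplementary w X y := by
  rw [← matVal_eq_sum_iff hX hy]
  rw [(matVal_eq_sum_iff hX₀ hy).mpr hc] at hle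
  exact le_antisymm (matVal_le_sum hX hy) hle

/-- The support of an optimal fractional matching contains that of a basic optimal one. -/
lemma exists_isRigid {G : SimpleGraph V} {w : Sym2 V → ℝ} {X : V → V → ℝ} {y : V → ℝ}
    (hX : IsFracMat G X) (hy : IsCover G w y) (hc : IsComplementary w X y) :
    ∃ X₁, IsFracMat G X₁ ∧ IsRigid X₁ ∧ IsComplementary w X₁ y ∧ ∀ a b, X₁ a b ≠ 0 → X a b ≠ 0 := by
  let H : SimpleGraph V :=
    { Adj := fun a b => X a b ≠ 0
      symm := ⟨fun a b h => by rwa [hX.symm]⟩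
      loopless := ⟨fun a h => G.loopless.irrefl a (hX.adj a a h)⟩ }
  -- Optimizing over the support graph of `X`, where `X` itself is feasible, cannot lose value. Only
  -- existence is used, not the cycle count.
  obtain ⟨X₁, hX₁, -⟩ := exists_isOptMat_ncard_eq_gamma H w
  have h1 : IsFracMat G X₁ := ⟨hX₁.frac.symm, hX₁.frac.nonneg,
    fun a b h => hX.adj a b (hX₁.frac.adj a b h), hX₁.frac.row⟩
  refine ⟨X₁, h1, hX₁.rigid, ?_, hX₁.frac.adj⟩
  exact isCompl_of_le hX hy hc h1 (hX₁.max X ⟨hX.symm, hX.nonneg, fun a b h => h, hX.row⟩)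

/-- Among the partial covers there is one of minimum value at `v`. -/
lemma exists_min_partialCover {G : SimpleGraph V} {w : Sym2 V → ℝ} {X : V → V → ℝ} {v : V}
    {y₀ : V → ℝ} (h₀ : IsPartialCover G w X v y₀) :
    ∃ y, IsPartialCover G w X v y ∧ ∀ z, IsPartialCover G w X v z → y v ≤ z v := by
  -- The cut `y v ≤ y₀ v` leaves the minimum unchanged and makes the set compact: a vertex other
  -- than `v` either has value 0, or is saturated and its value is at most the weight of a support
  -- edge.
  let K : Set (V → ℝ) := {y | IsPartialCover G w X v y ∧ y v ≤ y₀ v}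
  have hK : K = {y | (∀ a, 0 ≤ y a) ∧ (∀ a b, G.Adj a b → w s(a, b) ≤ y a + y b) ∧
      (∀ a b, X a b ≠ 0 → w s(a, b) = y a + y b) ∧ (∀ a, a ≠ v → ∑ b, X a b ≠ 1 → y a = 0) ∧
      y v ≤ y₀ v} := by
    ext y
    constructor
    · rintro ⟨⟨⟨h1, h2⟩, h3, h4⟩, h5⟩
      exact ⟨h1, h2, h3, h4, h5⟩
    · rintro ⟨h1, h2, h3, h4, h5⟩
      exact ⟨⟨⟨h1, h2⟩, h3, h4⟩, h5⟩
  have hcl : IsClosed K := by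
    rw [hK]
    simp only [Set.ofPred_and, Set.ofPred_forall]
    refine IsClosed.inter ?_ (IsClosed.inter ?_ (IsClosed.inter ?_ (IsClosed.inter ?_ ?_)))
    · exact isClosed_iInter fun a => isClosed_le continuous_const (continuous_apply a)
    · exact isClosed_iInter fun a => isClosed_iInter fun b => isClosed_iInter fun _ =>
        isClosed_le continuous_const ((continuous_apply a).add (continuous_apply b))
    · exact isClosed_iInter fun a => isClosed_iInter fun b => isClosed_iInter fun _ =>
        isClosed_eq continuous_const ((continuous_apply a).add (continuous_apply b))
    · exact isClosed_iInter fun a => isClosed_iInter fun _ => isClosed_iInter fun _ =>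
        isClosed_eq (continuous_apply a) continuous_const
    · exact isClosed_le (continuous_apply v) continuous_const
  have hbd : K ⊆ Set.Icc 0 (fun a => y₀ v + ∑ b, |w s(a, b)|) := by
    rintro y ⟨⟨⟨h1, h2⟩, h3, h4⟩, h5⟩
    refine ⟨h1, fun a => ?_⟩
    have hs : 0 ≤ ∑ b, |w s(a, b)| := Finset.sum_nonneg fun b _ => abs_nonneg _
    have hv := h₀.cover.nonneg v
    change y a ≤ y₀ v + ∑ b, |w s(a, b)|
    by_cases hav : a = v
    · subst hav; linarith
    by_cases hsum : ∑ b, X a b = 1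
    · obtain ⟨b, -, hb⟩ := Finset.exists_ne_zero_of_sum_ne_zero (by rw [hsum]; norm_num :
        ∑ b, X a b ≠ 0)
      have e1 := h3 a b hb
      have e2 := Finset.single_le_sum (f := fun b => |w s(a, b)|) (fun i _ => abs_nonneg _)
        (Finset.mem_univ b)
      have e3 := le_abs_self (w s(a, b))
      have e4 := h1 b
      linarith
    · rw [h4 a hav hsum]; linarith
  have hcomp : IsCompact K := isCompact_Icc.of_isClosed_subset hcl hbd
  obtain ⟨y, hy, hmin⟩ := hcomp.exists_isMinOn ⟨y₀, h₀, le_rfl⟩ (continuous_apply v).continuousOn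
  refine ⟨y, hy.1, fun z hz => ?_⟩
  rcases le_total (z v) (y₀ v) with h | h
  · exact hmin ⟨hz, h⟩
  · exact hy.2.trans h

end

end WGraph

/-! ### Alternating walks from the new vertex and the ways they succeed. -/

namespace WGraph

open Function

/-- The edge `{a, b}` of `G` is tight for the cover `y`. -/
def Tight {V : Type*} (G : SimpleGraph V) (w : Sym2 V → ℝ) (y : V → ℝ) (a b : V) : Prop :=
  G.Adj a b ∧ w s(a, b) = y a + y b

/-- A matching `f` of tight edges outside the long orbits of `σ` that exposes `t`, and apart from
`t` only vertices where `y` vanishes. -/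
structure IsState {V : Type*} (G : SimpleGraph V) (w : Sym2 V → ℝ) (y : V → ℝ)
    (σ : Equiv.Perm V) (t : V) (f : V → V) : Prop where
  invol : Involutive f
  fix : ∀ a, σ (σ a) ≠ a → f a = a
  tight : ∀ a, f a ≠ a → Tight G w y a (f a)
  exposed : f t = t
  short : σ (σ t) = t
  sat : ∀ a, σ (σ a) = a → a ≠ t → 0 < y a → f a ≠ a

/-- The matching formed by the orbits of `σ` of length two. -/
def baseMatching {V : Type*} [DecidableEq V] (σ : Equiv.Perm V) (a : V) : V :=
  if σ (σ a) = a then σ a else a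

/-- The states reachable along alternating walks of tight edges from `v`. -/
inductive Reach {V : Type*} [DecidableEq V] (G : SimpleGraph V) (w : Sym2 V → ℝ) (y : V → ℝ)
    (σ : Equiv.Perm V) (v : V) : V → (V → V) → Prop
  | base : Reach G w y σ v v (baseMatching σ)
  -- Conjugation by the transposition of `t` and `f a` replaces the matching edge `{a, f a}` by `{t,
  -- a}`, so `f a` becomes the exposed vertex.
  | step {t a : V} {f : V → V} (h : Reach G w y σ v t f) (hta : Tight G w y t a)
      (ha : σ (σ a) = a) (hfa : f a ≠ a) :
      Reach G w y σ v (f a) (fun b => Equiv.swap t (f a) (f (Equiv.swap t (f a) b)))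

/-- The fractional matching that agrees with `σ` on the long orbits and with `f` elsewhere. -/
noncomputable def stateMat {V : Type*} [DecidableEq V] (σ : Equiv.Perm V) (f : V → V)
    (c d : V) : ℝ :=
  if σ (σ c) = c then (if c ≠ d ∧ f c = d then 1 else 0) else halfMat σ c d

/-- The incidence matrix of an edge. -/
noncomputable def edgeMat {V : Type*} [DecidableEq V] (e : Sym2 V) (c d : V) : ℝ :=
  if s(c, d) = e then 1 else 0

/-- An optimal fractional matching whose support consists of the long orbits of `σ`, two matchings
of the remaining vertices, and one edge. -/
def Success {V : Type*} [Fintype V] [DecidableEq V] (G : SimpleGraph V) (w : Sym2 V → ℝ) (y : V → ℝ)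
    (σ : Equiv.Perm V) : Prop :=
  ∃ (X : V → V → ℝ) (f g : V → V) (e : Sym2 V), IsFracMat G X ∧ IsComplementary w X y ∧
    Involutive f ∧ ∀ a b, X a b ≠ 0 → s(a, b) = e ∨
      (σ (σ a) ≠ a ∧ σ (σ b) ≠ b ∧ halfMat σ a b ≠ 0) ∨
      (¬ σ (σ a) ≠ a ∧ ¬ σ (σ b) ≠ b ∧ (f a = b ∨ g a = b))

section

variable {V : Type*} {G : SimpleGraph V} {w : Sym2 V → ℝ} {y : V → ℝ} {σ : Equiv.Perm V} {v : V}

lemma Tight.symm {a b : V} (h : Tight G w y a b) : Tight G w y b a :=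
  ⟨h.1.symm, by rw [Sym2.eq_swap, h.2, add_comm]⟩

lemma IsState.short_apply {t : V} {f : V → V} (hf : IsState G w y σ t f) {a : V}
    (ha : σ (σ a) = a) : σ (σ (f a)) = f a := by
  by_contra h
  have h1 := hf.fix _ h
  rw [hf.invol] at h1
  exact h (by rw [← h1]; exact ha)

variable [DecidableEq V]

lemma swap_conj_apply {f : V → V} (hf : Involutive f) {t a : V} (ht : f t = t) (hta : t ≠ a)
    (hfa : f a ≠ a) (b : V) :
    Equiv.swap t (f a) (f (Equiv.swap t (f a) b)) =
      if b = t then a else if b = a then t else if b = f a then f a else f b := by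
  have hfat : f a ≠ t := fun h => by
    have := hf a
    rw [h, ht] at this
    exact hta this
  by_cases h1 : b = t
  · subst h1
    rw [if_pos rfl, Equiv.swap_apply_left, hf a, Equiv.swap_apply_of_ne_of_ne hta.symm hfa.symm]
  by_cases h2 : b = a
  · subst h2
    rw [if_neg h1, if_pos rfl, Equiv.swap_apply_of_ne_of_ne h1 hfa.symm, Equiv.swap_apply_right]
  by_cases h3 : b = f a
  · subst h3
    rw [if_neg h1, if_neg h2, if_pos rfl, Equiv.swap_apply_right, ht, Equiv.swap_apply_left]
  · rw [if_neg h1, if_neg h2, if_neg h3, Equiv.swap_apply_of_ne_of_ne h1 h3,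
      Equiv.swap_apply_of_ne_of_ne]
    · intro h; exact h1 (by rw [← hf b, h, ht])
    · intro h; exact h2 (hf.injective h)

lemma IsState.step {t a : V} {f : V → V} (hf : IsState G w y σ t f) (hta : Tight G w y t a)
    (ha : σ (σ a) = a) (hfa : f a ≠ a) :
    IsState G w y σ (f a) (fun b => Equiv.swap t (f a) (f (Equiv.swap t (f a) b))) := by
  have hne : t ≠ a := G.ne_of_adj hta.1
  have hap := swap_conj_apply hf.invol hf.exposed hne hfa
  have hfat : f a ≠ t := fun h => by
    have := hf.invol a
    rw [h, hf.exposed] at this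
    exact hne this
  refine ⟨fun b => ?_, fun b hb => ?_, fun b hb => ?_, ?_, hf.short_apply ha, fun b hb hbt hy => ?_⟩
  · simp only [Equiv.swap_apply_self, hf.invol (Equiv.swap t (f a) b)]
  · have h1 : b ≠ t := fun h => hb (h ▸ hf.short)
    have h2 : b ≠ a := fun h => hb (h ▸ ha)
    have h3 : b ≠ f a := fun h => hb (h ▸ hf.short_apply ha)
    simp only [hap, h1, h2, h3, if_false]
    exact hf.fix b hb
  · simp only [hap] at hb ⊢
    by_cases h1 : b = t
    · simp only [h1, if_true]; exact hta
    by_cases h2 : b = a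
    · simp only [h2, hne.symm, if_true, if_false]; exact hta.symm
    by_cases h3 : b = f a
    · simp [h3, hfa, hfat] at hb
    · simp only [h1, h2, h3, if_false] at hb ⊢
      exact hf.tight b hb
  · simp only [hap, hfa, hfat, if_true, if_false]
  · simp only [hap, hbt, if_false]
    by_cases h1 : b = t
    · simp only [h1, if_true]; exact hne.symm
    by_cases h2 : b = a
    · simp only [h2, hne.symm, if_true, if_false]; exact hne
    · simp only [h1, h2, if_false]
      exact hf.sat b hb h1 hy

lemma baseMatching_of_short {a : V} (ha : σ (σ a) = a) : baseMatching σ a = σ a := by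
  simp [baseMatching, ha]

lemma baseMatching_of_long {a : V} (ha : σ (σ a) ≠ a) : baseMatching σ a = a := by
  simp [baseMatching, ha]

lemma baseMatching_involutive : Involutive (baseMatching σ) := by
  intro a
  by_cases ha : σ (σ a) = a
  · rw [baseMatching_of_short ha, baseMatching_of_short (by rw [ha]), ha]
  · rw [baseMatching_of_long ha, baseMatching_of_long ha]

lemma halfMat_apply_ne_zero {a : V} (ha : σ a ≠ a) : halfMat σ a (σ a) ≠ 0 := by
  unfold halfMat
  rw [if_neg (Ne.symm ha), if_pos rfl]
  split_ifs <;> norm_num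

lemma Reach.isState [Fintype V] (hpc : IsPartialCover G w (halfMat σ) v y)
    (hadj : ∀ a b, halfMat σ a b ≠ 0 → G.Adj a b) (hv : σ v = v) {t : V} {f : V → V}
    (h : Reach G w y σ v t f) : IsState G w y σ t f := by
  induction h with
  | base =>
    refine ⟨baseMatching_involutive, fun a ha => baseMatching_of_long ha, fun a ha => ?_, ?_, ?_,
      fun a ha hav hy => ?_⟩
    · by_cases h : σ (σ a) = a
      · rw [baseMatching_of_short h] at ha ⊢
        have := halfMat_apply_ne_zero ha
        exact ⟨hadj _ _ this, hpc.tight _ _ this⟩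
      · exact absurd (baseMatching_of_long h) ha
    · rw [baseMatching_of_short (by rw [hv, hv]), hv]
    · rw [hv, hv]
    · rw [baseMatching_of_short ha]
      intro h
      exact hy.ne' (hpc.sat a hav (by rw [halfMat_row, if_pos h]; norm_num))
  | step _ hta ha hfa ih => exact ih.step hta ha hfa

/-- Every vertex keeps its partner, or it or its original partner becomes exposable. -/
lemma Reach.eq_or [Fintype V] (hpc : IsPartialCover G w (halfMat σ) v y)
    (hadj : ∀ a b, halfMat σ a b ≠ 0 → G.Adj a b) (hv : σ v = v) {t : V} {f : V → V}
    (h : Reach G w y σ v t f) (b : V) : f b = baseMatching σ b ∨ (∃ g, Reach G w y σ v b g) ∨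
      ∃ g, Reach G w y σ v (baseMatching σ b) g := by
  induction h with
  | base => exact Or.inl rfl
  | @step t a f h hta ha hfa ih =>
    have hs := h.isState hpc hadj hv
    beta_reduce
    rw [swap_conj_apply hs.invol hs.exposed (G.ne_of_adj hta.1) hfa]
    -- Only `t`, `a` and `f a` change partners. Both `t` and `f a` are exposed in some state; for
    -- `a`, the old partner `f a` is either the base partner, which is now exposed, or the induction
    -- hypothesis already gives an alternative.
    by_cases h1 : b = t
    · subst h1; exact Or.inr (Or.inl ⟨f, h⟩)
    by_cases h2 : b = a
    · subst h2
      rcases ih with h3 | h3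
      · exact Or.inr (Or.inr ⟨_, h3 ▸ h.step hta ha hfa⟩)
      · exact Or.inr h3
    by_cases h3 : b = f a
    · subst h3
      exact Or.inr (Or.inl ⟨_, h.step hta ha hfa⟩)
    · simp only [h1, h2, h3, if_false]
      exact ih

lemma short_of_halfMat_ne_zero {c d : V} (h : halfMat σ c d ≠ 0) :
    σ (σ c) = c ↔ σ (σ d) = d := by
  unfold halfMat at h
  by_cases hcd : c = d
  · simp [hcd] at h
  · rw [if_neg hcd] at h
    by_cases h1 : σ c = d
    · rw [← h1]
      exact σ.injective.eq_iff.symm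
    · by_cases h2 : σ d = c
      · rw [← h2]
        exact σ.injective.eq_iff
      · simp [h1, h2] at h

lemma stateMat_symm {t : V} {f : V → V} (hf : IsState G w y σ t f) (c d : V) :
    stateMat σ f c d = stateMat σ f d c := by
  unfold stateMat
  by_cases hc : σ (σ c) = c <;> by_cases hd : σ (σ d) = d
  · simp only [hc, hd, if_true]
    have : f c = d ↔ f d = c := by
      constructor
      · rintro rfl; exact hf.invol c
      · rintro rfl; exact hf.invol d
    simp only [this, ne_comm]
  · have h1 : f c ≠ d := fun h => hd (h ▸ hf.short_apply hc)
    have h2 : halfMat σ d c = 0 := by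
      by_contra h
      exact hd ((short_of_halfMat_ne_zero h).mpr hc)
    simp [hc, hd, h1, h2]
  · have h1 : f d ≠ c := fun h => hc (h ▸ hf.short_apply hd)
    have h2 : halfMat σ c d = 0 := by
      by_contra h
      exact hc ((short_of_halfMat_ne_zero h).mpr hd)
    simp [hc, hd, h1, h2]
  · simp only [hc, hd, if_false]
    exact halfMat_symm σ c d

lemma stateMat_nonneg (f : V → V) (c d : V) : 0 ≤ stateMat σ f c d := by
  unfold stateMat
  split_ifs
  · norm_num
  · norm_num
  · exact halfMat_nonneg σ c d

lemma stateMat_row [Fintype V] (f : V → V) (c : V) : ∑ d, stateMat σ f c d =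
    if σ (σ c) = c ∧ f c = c then 0 else 1 := by
  unfold stateMat
  by_cases hc : σ (σ c) = c
  · simp only [hc, if_true, true_and]
    by_cases h : f c = c
    · rw [if_pos h]
      exact Finset.sum_eq_zero fun d _ => if_neg fun hd => hd.1 (h.symm.trans hd.2)
    · rw [if_neg h, Finset.sum_eq_single (f c)]
      · simp [Ne.symm h]
      · intro d _ hd
        exact if_neg fun h' => hd h'.2.symm
      · simp
  · simp only [hc, if_false, false_and]
    rw [halfMat_row, if_neg]
    intro h
    exact hc (by rw [h, h])

lemma stateMat_ne_zero {t : V} {f : V → V} (hf : IsState G w y σ t f) {c d : V}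
    (h : stateMat σ f c d ≠ 0) : (halfMat σ c d ≠ 0 ∧ σ (σ c) ≠ c ∧ σ (σ d) ≠ d) ∨
      (Tight G w y c d ∧ ¬ σ (σ c) ≠ c ∧ ¬ σ (σ d) ≠ d ∧ f c = d) := by
  unfold stateMat at h
  by_cases hc : σ (σ c) = c
  · simp only [hc, if_true, ne_eq, ite_eq_right_iff, one_ne_zero, imp_false, not_not] at h
    obtain ⟨h1, rfl⟩ := h
    refine Or.inr ⟨hf.tight c (Ne.symm h1), not_not.mpr hc, not_not.mpr (hf.short_apply hc), rfl⟩
  · simp only [hc, if_false] at h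
    exact Or.inl ⟨h, hc, fun hd => hc ((short_of_halfMat_ne_zero h).mpr hd)⟩

lemma edgeMat_symm (e : Sym2 V) (c d : V) : edgeMat e c d = edgeMat e d c := by
  unfold edgeMat
  rw [Sym2.eq_swap]

lemma edgeMat_nonneg (e : Sym2 V) (c d : V) : 0 ≤ edgeMat e c d := by
  unfold edgeMat
  split_ifs <;> norm_num

lemma edgeMat_row [Fintype V] {p q : V} (h : p ≠ q) (c : V) : ∑ d, edgeMat s(p, q) c d =
    (if c = p then 1 else 0) + (if c = q then 1 else 0) :=
  sum_ite_mk_eq c p q h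

lemma edgeMat_ne_zero {e : Sym2 V} {c d : V} (h : edgeMat e c d ≠ 0) : s(c, d) = e := by
  unfold edgeMat at h
  by_contra hn
  simp [hn] at h

lemma success_of [Fintype V] {X : V → V → ℝ} (hsymm : ∀ a b, X a b = X b a)
    (hnonneg : ∀ a b, 0 ≤ X a b) (f g : V → V) (e : Sym2 V) (hf : Involutive f)
    (hsupp : ∀ a b, X a b ≠ 0 → Tight G w y a b ∧ (s(a, b) = e ∨ (σ (σ a) ≠ a ∧ σ (σ b) ≠ b ∧ halfMat σ a b ≠ 0) ∨
      (¬ σ (σ a) ≠ a ∧ ¬ σ (σ b) ≠ b ∧ (f a = b ∨ g a = b))))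
    (hrow : ∀ a, ∑ b, X a b ≤ 1 ∧ (0 < y a → ∑ b, X a b = 1)) : Success G w y σ :=
  ⟨X, f, g, e, ⟨hsymm, hnonneg, fun a b h => (hsupp a b h).1.1, fun a => (hrow a).1⟩,
    ⟨fun a b h => (hsupp a b h).1.2, fun a => (hrow a).2⟩, hf, fun a b h => (hsupp a b h).2⟩

variable [Fintype V] {t : V} {f : V → V}

lemma success_of_eq_zero (hT : ∀ a b, halfMat σ a b ≠ 0 → Tight G w y a b)
    (hf : IsState G w y σ t f) (ht : y t = 0) : Success G w y σ := by
  -- A vertex of cover value zero may stay exposed. No extra edge is needed, and the loop `s(t, t)`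
  -- merely fills the slot.
  refine success_of (stateMat_symm hf) (stateMat_nonneg f) f f s(t, t) hf.invol ?_ ?_
  · intro a b h
    rcases stateMat_ne_zero hf h with ⟨h1, h2, h3⟩ | ⟨h1, h2, h3, h4⟩
    · exact ⟨hT _ _ h1, Or.inr (Or.inl ⟨h2, h3, h1⟩)⟩
    · exact ⟨h1, Or.inr (Or.inr ⟨h2, h3, Or.inl h4⟩)⟩
  · intro a
    rw [stateMat_row]
    split_ifs with h
    · refine ⟨zero_le_one, fun hy => ?_⟩
      have hat : a ≠ t := fun h' => by subst h'; exact hy.ne' ht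
      exact absurd h.2 (hf.sat a h.1 hat hy)
    · exact ⟨le_rfl, fun _ => rfl⟩

/-- Both ends of the tight edge are exposed by `f`, so the matching is augmented by it. -/
lemma success_of_exposed (hT : ∀ a b, halfMat σ a b ≠ 0 → Tight G w y a b)
    (hf : IsState G w y σ t f) {a : V} (hta : Tight G w y t a) (ha : σ (σ a) = a)
    (hfa : f a = a) : Success G w y σ := by
  have hne := G.ne_of_adj hta.1
  refine success_of (X := fun c d => stateMat σ f c d + edgeMat s(t, a) c d)
    (fun c d => by rw [stateMat_symm hf, edgeMat_symm])
    (fun c d => add_nonneg (stateMat_nonneg f c d) (edgeMat_nonneg _ c d)) f f s(t, a) hf.invol ?_ ?_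
  · intro c d h
    by_cases h' : stateMat σ f c d = 0
    · rw [h', zero_add] at h
      have he := edgeMat_ne_zero h
      refine ⟨?_, Or.inl he⟩
      rcases Sym2.eq_iff.mp he with ⟨rfl, rfl⟩ | ⟨rfl, rfl⟩
      · exact hta
      · exact hta.symm
    · rcases stateMat_ne_zero hf h' with ⟨h1, h2, h3⟩ | ⟨h1, h2, h3, h4⟩
      · exact ⟨hT _ _ h1, Or.inr (Or.inl ⟨h2, h3, h1⟩)⟩
      · exact ⟨h1, Or.inr (Or.inr ⟨h2, h3, Or.inl h4⟩)⟩
  · intro c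
    rw [Finset.sum_add_distrib, stateMat_row, edgeMat_row hne]
    by_cases h1 : c = t
    · subst h1; simp [hf.short, hf.exposed, hne]
    by_cases h2 : c = a
    · subst h2; simp [ha, hfa, h1]
    by_cases h3 : σ (σ c) = c ∧ f c = c
    · simp only [h1, h2, h3, and_self, if_true, if_false, add_zero]
      exact ⟨zero_le_one, fun hy => absurd h3.2 (hf.sat c h3.1 h1 hy)⟩
    · simp [h1, h2, h3]

/-- The two states and the edge `{t, a}` are added with weight `1/2` each. Positivity of the cover
makes `g` cover `t` and `f` cover `a`, so the edge supplies exactly their missing half. The new odd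
cycle need not be located. -/
lemma success_of_blossom (hT : ∀ a b, halfMat σ a b ≠ 0 → Tight G w y a b)
    (hf : IsState G w y σ t f) {a : V} {g : V → V} (hg : IsState G w y σ a g)
    (hta : Tight G w y t a) (hyt : 0 < y t) (hya : 0 < y a) : Success G w y σ := by
  have hne := G.ne_of_adj hta.1
  refine success_of
    (X := fun c d => (stateMat σ f c d + stateMat σ g c d + edgeMat s(t, a) c d) / 2)
    (fun c d => by rw [stateMat_symm hf, stateMat_symm hg, edgeMat_symm])
    (fun c d => div_nonneg (add_nonneg (add_nonneg (stateMat_nonneg f c d) (stateMat_nonneg g c d))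
      (edgeMat_nonneg _ c d)) zero_le_two) f g s(t, a) hf.invol ?_ ?_
  · intro c d h
    by_cases h' : stateMat σ f c d = 0
    · by_cases h'' : stateMat σ g c d = 0
      · have he : edgeMat s(t, a) c d ≠ 0 := by
          intro h0
          simp [h', h'', h0] at h
        have he := edgeMat_ne_zero he
        refine ⟨?_, Or.inl he⟩
        rcases Sym2.eq_iff.mp he with ⟨rfl, rfl⟩ | ⟨rfl, rfl⟩
        · exact hta
        · exact hta.symm
      · rcases stateMat_ne_zero hg h'' with ⟨h1, h2, h3⟩ | ⟨h1, h2, h3, h4⟩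
        · exact ⟨hT _ _ h1, Or.inr (Or.inl ⟨h2, h3, h1⟩)⟩
        · exact ⟨h1, Or.inr (Or.inr ⟨h2, h3, Or.inr h4⟩)⟩
    · rcases stateMat_ne_zero hf h' with ⟨h1, h2, h3⟩ | ⟨h1, h2, h3, h4⟩
      · exact ⟨hT _ _ h1, Or.inr (Or.inl ⟨h2, h3, h1⟩)⟩
      · exact ⟨h1, Or.inr (Or.inr ⟨h2, h3, Or.inl h4⟩)⟩
  · intro c
    rw [← Finset.sum_div, Finset.sum_add_distrib, Finset.sum_add_distrib, stateMat_row,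
      stateMat_row, edgeMat_row hne]
    by_cases h1 : c = t
    · subst h1
      have := hg.sat c hf.short hne hyt
      simp only [hf.short, hf.exposed, this, hne, and_self, and_false, if_true, if_false]
      norm_num
    by_cases h2 : c = a
    · subst h2
      have := hf.sat c hg.short h1 hya
      simp only [hg.short, hg.exposed, this, h1, and_self, and_false, if_true, if_false]
      norm_num
    simp only [h1, h2, if_false, add_zero]
    by_cases hc : 0 < y c ∨ σ (σ c) ≠ c
    · have h3 : ¬ (σ (σ c) = c ∧ f c = c) := fun h3 =>
        hc.elim (fun hy => hf.sat c h3.1 h1 hy h3.2) fun h => h h3.1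
      have h4 : ¬ (σ (σ c) = c ∧ g c = c) := fun h3 =>
        hc.elim (fun hy => hg.sat c h3.1 h2 hy h3.2) fun h => h h3.1
      rw [if_neg h3, if_neg h4]
      norm_num
    · have hy : ¬ 0 < y c := fun h => hc (Or.inl h)
      refine ⟨?_, fun h => absurd h hy⟩
      split_ifs <;> norm_num

/-- On the odd orbit through `a` the alternating sum is `+1` on both edges at `a`. Subtracting half
of it turns the values `1/2` into 0 and 1, leaving a matching of the orbit that misses only `a`; the
edge `{t, a}` then covers both `t` and `a`. -/
lemma success_of_cycle (hr : IsRigid (halfMat σ))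
    (hT : ∀ a b, halfMat σ a b ≠ 0 → Tight G w y a b)
    (hf : IsState G w y σ t f) {a : V} (hta : Tight G w y t a) (ha : σ (σ a) ≠ a) :
    Success G w y σ := by
  have hne := G.ne_of_adj hta.1
  have h3 := three_le_minimalPeriod ha
  have hodd := odd_minimalPeriod hr ha
  have ha1 : σ a ≠ a := fun h => ha (by rw [h, h])
  set D := altMat (fun j => σ^[j] a) (minimalPeriod σ a) with hD
  have hDhalf : ∀ c d, D c d ≠ 0 → σ (σ c) ≠ c ∧ halfMat σ c d = 1 / 2 := by
    intro c d hcd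
    obtain ⟨j, hj, h⟩ := exists_of_altMat_ne_zero hcd
    have hlong := iterate_sq_ne ha j
    have hval : halfMat σ (σ^[j] a) (σ^[j + 1] a) = 1 / 2 := by
      rw [iterate_succ_apply']
      exact halfMat_eq_half hlong
    rcases Sym2.eq_iff.mp h with ⟨rfl, rfl⟩ | ⟨rfl, rfl⟩
    · exact ⟨hlong, hval⟩
    · refine ⟨iterate_sq_ne ha (j + 1), ?_⟩
      rw [halfMat_symm, hval]
  have hDrow : ∀ c, ∑ d, D c d = 2 * if c = a then 1 else 0 := by
    intro c
    rw [hD, altMat_row _ (iterate_ne_succ ha1), hodd.neg_one_pow, iterate_minimalPeriod]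
    by_cases h : c = a
    · simp [h]; norm_num
    · simp [h]
  have hle : ∀ c d, D c d / 2 ≤ stateMat σ f c d := by
    intro c d
    by_cases h : D c d = 0
    · rw [h, zero_div]; exact stateMat_nonneg f c d
    · obtain ⟨h1, h2⟩ := hDhalf c d h
      have h4 := (abs_le.mp (abs_altMat_orbit_le h3 c d)).2
      rw [stateMat, if_neg h1, h2]
      linarith
  refine success_of (X := fun c d => stateMat σ f c d - D c d / 2 + edgeMat s(t, a) c d)
    (fun c d => by rw [stateMat_symm hf, edgeMat_symm, hD, altMat_symm])
    (fun c d => add_nonneg (sub_nonneg.mpr (hle c d)) (edgeMat_nonneg _ c d)) f f s(t, a)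
    hf.invol ?_ ?_
  · intro c d h
    by_cases h' : stateMat σ f c d = 0
    · have h0 : D c d = 0 := by
        by_contra h0
        obtain ⟨h1, h2⟩ := hDhalf c d h0
        rw [stateMat, if_neg h1, h2] at h'
        norm_num at h'
      rw [h', h0, zero_div, sub_zero, zero_add] at h
      have he := edgeMat_ne_zero h
      refine ⟨?_, Or.inl he⟩
      rcases Sym2.eq_iff.mp he with ⟨rfl, rfl⟩ | ⟨rfl, rfl⟩
      · exact hta
      · exact hta.symm
    · rcases stateMat_ne_zero hf h' with ⟨h1, h2, h3⟩ | ⟨h1, h2, h3, h4⟩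
      · exact ⟨hT _ _ h1, Or.inr (Or.inl ⟨h2, h3, h1⟩)⟩
      · exact ⟨h1, Or.inr (Or.inr ⟨h2, h3, Or.inl h4⟩)⟩
  · intro c
    rw [Finset.sum_add_distrib, Finset.sum_sub_distrib, ← Finset.sum_div, hDrow, stateMat_row,
      edgeMat_row hne]
    by_cases h1 : c = t
    · subst h1; simp [hf.short, hf.exposed, hne]
    by_cases h2 : c = a
    · subst h2; simp [ha, h1]
    by_cases h3 : σ (σ c) = c ∧ f c = c
    · simp only [h1, h2, h3, and_self, if_true, if_false, add_zero, mul_zero, zero_div, sub_zero]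
      exact ⟨zero_le_one, fun hy => absurd h3.2 (hf.sat c h3.1 h1 hy)⟩
    · simp [h1, h2, h3]

end

end WGraph

/-! ### Changing the cover, and the effect of adding one vertex. -/

namespace WGraph

open Function

section

variable {V : Type*} [DecidableEq V] {G : SimpleGraph V} {w : Sym2 V → ℝ} {y : V → ℝ}
  {σ : Equiv.Perm V} {v : V}

lemma halfMat_eq_half_of_ne_zero {a b : V} (ha : σ (σ a) ≠ a) (h : halfMat σ a b ≠ 0) :
    halfMat σ a b = 1 / 2 := by
  unfold halfMat at h ⊢
  by_cases hab : a = b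
  · simp [hab] at h
  · rw [if_neg hab] at h ⊢
    by_cases h1 : σ a = b
    · have h2 : σ b ≠ a := fun h2 => ha (by rw [h1, h2])
      simp [h1, h2]
    · by_cases h2 : σ b = a
      · simp [h1, h2]
      · simp [h1, h2] at h

variable [Fintype V]

/-- A partial cover of minimum value at `v` leads to an optimal fractional matching: otherwise
the cover could be lowered on the reachable vertices and raised on their neighbours. -/
lemma success_of_min (hr : IsRigid (halfMat σ)) (hadj : ∀ a b, halfMat σ a b ≠ 0 → G.Adj a b)
    (hv : σ v = v) (hpc : IsPartialCover G w (halfMat σ) v y)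
    (hmin : ∀ z, IsPartialCover G w (halfMat σ) v z → y v ≤ z v) : Success G w y σ := by
  classical
  by_contra hS
  have hT : ∀ a b, halfMat σ a b ≠ 0 → Tight G w y a b :=
    fun a b h => ⟨hadj a b h, hpc.tight a b h⟩
  -- `O` holds the exposable vertices and `N` their tight neighbours. Without success they are
  -- disjoint, avoid the long orbits, and `σ` exchanges `N` with `O` minus `v`.
  let O : Set V := {t | ∃ f, Reach G w y σ v t f}
  let N : Set V := {a | ∃ t ∈ O, Tight G w y t a}
  have hOpos : ∀ t ∈ O, 0 < y t := by
    rintro t ⟨f, hf⟩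
    refine lt_of_le_of_ne (hpc.cover.nonneg t) fun h => hS ?_
    exact success_of_eq_zero hT (hf.isState hpc hadj hv) h.symm
  have hOshort : ∀ t ∈ O, σ (σ t) = t := by
    rintro t ⟨f, hf⟩
    exact (hf.isState hpc hadj hv).short
  have hNshort : ∀ a ∈ N, σ (σ a) = a := by
    rintro a ⟨t, ⟨f, hf⟩, hta⟩
    by_contra ha
    exact hS (success_of_cycle hr hT (hf.isState hpc hadj hv) hta ha)
  have hdisj : ∀ a ∈ N, a ∉ O := by
    rintro a ⟨t, ht, hta⟩ ha
    obtain ⟨f, hf⟩ := ht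
    obtain ⟨g, hg⟩ := id ha
    exact hS (success_of_blossom hT (hf.isState hpc hadj hv) (hg.isState hpc hadj hv) hta
      (hOpos t ⟨f, hf⟩) (hOpos a ha))
  have hvO : v ∈ O := ⟨_, Reach.base⟩
  have hNO : ∀ a ∈ N, σ a ∈ O := by
    intro a haN
    have ha := hNshort a haN
    have haO := hdisj a haN
    obtain ⟨t, ⟨f, hf⟩, hta⟩ := haN
    have hs := hf.isState hpc hadj hv
    have hfa : f a ≠ a := fun h => hS (success_of_exposed hT hs hta ha h)
    rw [← baseMatching_of_short ha]
    rcases hf.eq_or hpc hadj hv a with h | h | h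
    · rw [← h]
      exact ⟨_, hf.step hta ha hfa⟩
    · exact absurd h haO
    · exact h
  have hON : ∀ a ∈ O, a ≠ v → σ a ≠ a ∧ σ a ∈ N := by
    intro a haO hav
    have hne : σ a ≠ a := by
      intro h
      exact (hOpos a haO).ne' (hpc.sat a hav (by rw [halfMat_row, if_pos h]; norm_num))
    exact ⟨hne, a, haO, hT _ _ (halfMat_apply_ne_zero hne)⟩
  have hNne : ∀ a ∈ N, σ a ≠ a := fun a ha h => hdisj a ha (h ▸ hNO a ha)
  -- The factor 2 is for slack edges with both ends in `O`, each lowered by `ε`.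
  obtain ⟨ε, hε, hε1, hε2⟩ : ∃ ε : ℝ, 0 < ε ∧ (∀ t, 0 < y t → ε ≤ y t) ∧
      ∀ a b, w s(a, b) < y a + y b → 2 * ε ≤ y a + y b - w s(a, b) := by
    have hle : ∀ δ : ℝ, 0 < δ → ∀ᶠ ε in nhdsWithin (0 : ℝ) (Set.Ioi 0), ε ≤ δ := fun δ hδ => by
      filter_upwards [Ioc_mem_nhdsGT hδ] with ε h using h.2
    have h1 : ∀ᶠ ε in nhdsWithin (0 : ℝ) (Set.Ioi 0), ∀ t, 0 < y t → ε ≤ y t := by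
      rw [Filter.eventually_all]
      intro t
      by_cases ht : 0 < y t
      · exact (hle _ ht).mono fun ε h _ => h
      · exact Filter.Eventually.of_forall fun ε h => absurd h ht
    have h2 : ∀ᶠ ε in nhdsWithin (0 : ℝ) (Set.Ioi 0), ∀ a b, w s(a, b) < y a + y b →
        2 * ε ≤ y a + y b - w s(a, b) := by
      rw [Filter.eventually_all]
      intro a
      rw [Filter.eventually_all]
      intro b
      by_cases hab : w s(a, b) < y a + y b
      · exact (hle ((y a + y b - w s(a, b)) / 2) (by linarith)).mono fun ε h _ => by linarith
      · exact Filter.Eventually.of_forall fun ε h => absurd h hab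
    obtain ⟨ε, h3, h4, h5⟩ := (Filter.Eventually.and eventually_mem_nhdsWithin (h1.and h2)).exists
    exact ⟨ε, h3, h4, h5⟩
  let z : V → ℝ := fun c => y c - (if c ∈ O then ε else 0) + if c ∈ N then ε else 0
  have hzO : ∀ c ∈ O, z c = y c - ε := fun c hc => by
    have : c ∉ N := fun h => hdisj c h hc
    simp [z, hc, this]
  have hzN : ∀ c ∈ N, z c = y c + ε := fun c hc => by
    simp [z, hc, hdisj c hc]
  have hz : ∀ c, c ∉ O → c ∉ N → z c = y c := fun c h1 h2 => by
    simp [z, h1, h2]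
  have hzlow : ∀ c, y c - ε ≤ z c := fun c => by
    by_cases h1 : c ∈ O
    · exact (hzO c h1).ge
    · by_cases h2 : c ∈ N
      · rw [hzN c h2]; linarith
      · rw [hz c h1 h2]; linarith
  have hzge : ∀ c, c ∉ O → y c ≤ z c := fun c h1 => by
    by_cases h2 : c ∈ N
    · rw [hzN c h2]; linarith
    · rw [hz c h1 h2]
  have hzcover : IsCover G w z := by
    refine ⟨fun a => ?_, fun a b hab => ?_⟩
    · by_cases ha : a ∈ O
      · rw [hzO a ha]; linarith [hε1 a (hOpos a ha)]
      · exact (hpc.cover.nonneg a).trans (hzge a ha)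
    · rcases (hpc.cover.edge a b hab).eq_or_lt with h | h
      · have htight : Tight G w y a b := ⟨hab, h⟩
        by_cases ha : a ∈ O
        · rw [hzO a ha, hzN b ⟨a, ha, htight⟩]; linarith
        · by_cases hb : b ∈ O
          · rw [hzO b hb, hzN a ⟨b, hb, htight.symm⟩]; linarith
          · linarith [hzge a ha, hzge b hb]
      · linarith [hε2 a b h, hzlow a, hzlow b]
  -- In a matching edge of `σ` one end is in `O` exactly when the other is in `N`, so the changes
  -- cancel; long orbits are untouched.
  have hztight : ∀ a b, halfMat σ a b ≠ 0 → w s(a, b) = z a + z b := by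
    have key : ∀ a b, σ a = b → a ≠ b → w s(a, b) = y a + y b → w s(a, b) = z a + z b := by
      intro a b hab hne h
      by_cases hlong : σ (σ a) = a
      · have hba : σ b = a := by rw [← hab]; exact hlong
        by_cases ha : a ∈ O
        · have hav : a ≠ v := by
            rintro rfl
            exact hne (hv.symm.trans hab)
          rw [hzO a ha, hzN b (hab ▸ (hON a ha hav).2)]; linarith
        by_cases hb : b ∈ O
        · have hbv : b ≠ v := by
            rintro rfl
            exact hne (hba.symm.trans hv)
          rw [hzO b hb, hzN a (hba ▸ (hON b hb hbv).2)]; linarith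
        · have haN : a ∉ N := fun h => hb (hab ▸ hNO a h)
          have hbN : b ∉ N := fun h => ha (hba ▸ hNO b h)
          rw [hz a ha haN, hz b hb hbN, h]
      · have hlong' : σ (σ b) ≠ b := by
          rw [← hab]
          exact fun h => hlong (σ.injective h)
        rw [hz a (fun h => hlong (hOshort a h)) (fun h => hlong (hNshort a h)),
          hz b (fun h => hlong' (hOshort b h)) (fun h => hlong' (hNshort b h)), h]
    intro a b h
    have hne : a ≠ b := G.ne_of_adj (hadj a b h)
    have ht := hpc.tight a b h
    unfold halfMat at h
    rw [if_neg hne] at h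
    by_cases h1 : σ a = b
    · exact key a b h1 hne ht
    · by_cases h2 : σ b = a
      · rw [Sym2.eq_swap, add_comm (z a)]
        exact key b a h2 hne.symm (by rw [Sym2.eq_swap, ht, add_comm])
      · simp [h1, h2] at h
  have hzsat : ∀ a, a ≠ v → ∑ b, halfMat σ a b ≠ 1 → z a = 0 := by
    intro a hav ha
    have hσ : σ a = a := by
      by_contra h
      rw [halfMat_row, if_neg h] at ha
      exact ha rfl
    rw [hz a (fun h => (hON a h hav).1 hσ) (fun h => hNne a h hσ)]
    exact hpc.sat a hav ha
  have := hmin z ⟨hzcover, hztight, hzsat⟩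
  rw [hzO v hvO] at this
  linarith

/-- Adding the vertex `v` to a graph increases the number of odd cycles by at most one. -/
theorem exists_add_vertex {G' : SimpleGraph V} (hG : ∀ a b, G'.Adj a b ↔ G.Adj a b ∧ a ≠ v ∧ b ≠ v)
    {X' : V → V → ℝ} {y' : V → ℝ} (hX' : IsFracMat G' X') (hr' : IsRigid X')
    (hy' : IsCover G' w y') (hc' : IsComplementary w X' y') :
    ∃ X y, IsFracMat G X ∧ IsRigid X ∧ IsCover G w y ∧ IsComplementary w X y ∧
      (oddCycleSets X).ncard ≤ (oddCycleSets X').ncard + 1 := by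
  obtain ⟨σ, rfl⟩ := exists_eq_halfMat hX' hr'
  have hadj : ∀ a b, halfMat σ a b ≠ 0 → G.Adj a b :=
    fun a b h => ((hG a b).mp (hX'.adj a b h)).1
  have hv : σ v = v := by
    by_contra h
    exact ((hG _ _).mp (hX'.adj _ _ (halfMat_apply_ne_zero h))).2.1 rfl
  -- The value at `v` only has to dominate all weights at `v`, since slackness is not demanded
  -- there.
  let y₀ : V → ℝ := Function.update y' v (∑ b, |w s(v, b)|)
  have hy₀v : y₀ v = ∑ b, |w s(v, b)| := Function.update_self ..
  have hy₀ : ∀ a, a ≠ v → y₀ a = y' a := fun a ha => Function.update_of_ne ha ..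
  have hbound : ∀ b, w s(v, b) ≤ y₀ v := fun b => by
    rw [hy₀v]
    exact (le_abs_self _).trans (Finset.single_le_sum (f := fun b => |w s(v, b)|)
      (fun i _ => abs_nonneg _) (Finset.mem_univ b))
  have hnonneg : ∀ a, 0 ≤ y₀ a := fun a => by
    by_cases ha : a = v
    · subst ha; rw [hy₀v]; exact Finset.sum_nonneg fun b _ => abs_nonneg _
    · rw [hy₀ a ha]; exact hy'.nonneg a
  have hpc₀ : IsPartialCover G w (halfMat σ) v y₀ := by
    refine ⟨⟨hnonneg, fun a b hab => ?_⟩, fun a b h => ?_, fun a ha h => ?_⟩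
    · by_cases ha : a = v
      · subst ha; linarith [hbound b, hnonneg b]
      by_cases hb : b = v
      · subst hb; rw [Sym2.eq_swap]; linarith [hbound a, hnonneg a]
      rw [hy₀ a ha, hy₀ b hb]
      exact hy'.edge a b ((hG a b).mpr ⟨hab, ha, hb⟩)
    · obtain ⟨-, ha, hb⟩ := (hG a b).mp (hX'.adj a b h)
      rw [hy₀ a ha, hy₀ b hb]
      exact hc'.tight a b h
    · rw [hy₀ a ha]
      by_contra h0
      exact h (hc'.sat a (lt_of_le_of_ne (hy'.nonneg a) (Ne.symm h0)))
  obtain ⟨y, hy, hmin⟩ := exists_min_partialCover hpc₀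
  obtain ⟨X, f, g, e, hX, hc, hf, hsupp⟩ := success_of_min hr' hadj hv hy hmin
  obtain ⟨X₁, hX₁, hr₁, hc₁, hsub⟩ := exists_isRigid hX hy.cover hc
  refine ⟨X₁, y, hX₁, hr₁, hy.cover, hc₁, ncard_oddCycleSets_le hX₁ e fun C hC he => ?_⟩
  -- `W` is the union of the long orbits, where every support edge of `halfMat σ` has value `1/2`.
  refine mem_oddCycleSets_of_subset (W := {a | σ (σ a) ≠ a}) (g := g) hf hC fun a b hab => ?_
  have hne : X a b ≠ 0 := hsub a b (by rw [hC.1 a b hab]; norm_num)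
  rcases hsupp a b hne with h | ⟨h1, h2, h3⟩ | h
  · exact absurd (h ▸ hab) he
  · exact Or.inl ⟨h1, h2, halfMat_eq_half_of_ne_zero h1 h3⟩
  · exact Or.inr h

end

end WGraph

/-! ### Vertex deletion, induction on the deleted set, and stable graphs. -/

namespace WGraph

/-- The spanning subgraph of the edges of `G` inside `U`. -/
def restrictTo {V : Type*} (G : SimpleGraph V) (U : Set V) : SimpleGraph V where
  Adj a b := G.Adj a b ∧ a ∈ U ∧ b ∈ U
  symm := ⟨fun _ _ h => ⟨h.1.symm, h.2.2, h.2.1⟩⟩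
  loopless := ⟨fun a h => G.loopless.irrefl a h.1⟩

open Classical in
/-- Extension by zero of a matrix on a set of vertices. -/
noncomputable def extMat {V : Type*} {U : Set V} (X : U → U → ℝ) (a b : V) : ℝ :=
  if h : a ∈ U ∧ b ∈ U then X ⟨a, h.1⟩ ⟨b, h.2⟩ else 0

section

variable {V : Type*}

lemma restrictTo_univ (G : SimpleGraph V) : restrictTo G Set.univ = G := by
  ext a b
  simp [restrictTo]

lemma restrictTo_adj_iff {G : SimpleGraph V} {U : Set V} {v : V} (hv : v ∉ U) (a b : V) :
    (restrictTo G U).Adj a b ↔ (restrictTo G (insert v U)).Adj a b ∧ a ≠ v ∧ b ≠ v := by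
  simp only [restrictTo, Set.mem_insert_iff]
  constructor
  · rintro ⟨h1, h2, h3⟩
    exact ⟨⟨h1, Or.inr h2, Or.inr h3⟩, fun h => hv (h ▸ h2), fun h => hv (h ▸ h3)⟩
  · rintro ⟨⟨h1, h2, h3⟩, h4, h5⟩
    exact ⟨h1, h2.resolve_left h4, h3.resolve_left h5⟩

lemma extMat_mk {U : Set V} (X : U → U → ℝ) (a b : U) : extMat X a b = X a b := by
  simp [extMat]

lemma extMat_of_not_left {U : Set V} (X : U → U → ℝ) {a : V} (ha : a ∉ U) (b : V) :
    extMat X a b = 0 := by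
  simp [extMat, ha]

lemma extMat_of_not_right {U : Set V} (X : U → U → ℝ) (a : V) {b : V} (hb : b ∉ U) :
    extMat X a b = 0 := by
  simp [extMat, hb]

lemma mem_of_extMat_ne_zero {U : Set V} {X : U → U → ℝ} {a b : V} (h : extMat X a b ≠ 0) :
    a ∈ U ∧ b ∈ U := by
  by_contra hn
  exact h (dif_neg hn)

lemma sum_eq_sum_subtype [Fintype V] {U : Set V} [Fintype U] (F : V → ℝ) (hF : ∀ b, b ∉ U → F b = 0) :
    ∑ b, F b = ∑ b : U, F b :=
  (Fintype.sum_of_injective (Subtype.val : U → V) Subtype.val_injective (fun b => F b) F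
    (fun b hb => hF b fun h => hb ⟨⟨b, h⟩, rfl⟩) fun _ => rfl).symm

lemma extMat_row [Fintype V] {U : Set V} [Fintype U] (X : U → U → ℝ) (a : U) :
    ∑ b, extMat X a b = ∑ b, X a b := by
  rw [sum_eq_sum_subtype (U := U) _ fun b hb => extMat_of_not_right X _ hb]
  simp only [extMat_mk]

lemma matVal_eq_matVal_subtype [Fintype V] {U : Set V} [Fintype U] (w : Sym2 V → ℝ) {Y : V → V → ℝ}
    (hY : ∀ a b, Y a b ≠ 0 → a ∈ U ∧ b ∈ U) :
    matVal w Y = matVal (fun e => w (e.map Subtype.val)) (fun a b : U => Y a b) := by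
  have h0 : ∀ a b, ¬ (a ∈ U ∧ b ∈ U) → w s(a, b) * Y a b = 0 := fun a b h => by
    by_cases h' : Y a b = 0
    · rw [h', mul_zero]
    · exact absurd (hY a b h') h
  unfold matVal
  rw [sum_eq_sum_subtype (U := U) _ fun a ha => Finset.sum_eq_zero fun b _ => h0 a b fun h => ha h.1]
  congr 1
  refine Finset.sum_congr rfl fun a _ => ?_
  rw [sum_eq_sum_subtype (U := U) _ fun b hb => h0 a b fun h => hb h.2]
  rfl

/-- Passing from the induced subgraph to the same edges on all of `V` adds isolated vertices only,
where feasible matrices and admissible perturbations vanish. -/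
lemma isOptMat_extMat [Fintype V] {G : SimpleGraph V} {w : Sym2 V → ℝ} {S : Set V}
    [Fintype (Sᶜ : Set V)] {X : (Sᶜ : Set V) → (Sᶜ : Set V) → ℝ}
    (hX : IsOptMat (deleteVerts G S) (deleteWeight w S) X) :
    IsOptMat (restrictTo G Sᶜ) w (extMat X) := by
  refine ⟨⟨fun a b => ?_, fun a b => ?_, fun a b h => ?_, fun a => ?_⟩, fun D hD h0 hrow => ?_,
    fun Y hY => ?_⟩
  · unfold extMat
    by_cases h : a ∈ Sᶜ ∧ b ∈ Sᶜ
    · rw [dif_pos h, dif_pos h.symm, hX.frac.symm]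
    · rw [dif_neg h, dif_neg fun h' => h h'.symm]
  · unfold extMat
    split_ifs
    · exact hX.frac.nonneg _ _
    · exact le_rfl
  · obtain ⟨ha, hb⟩ := mem_of_extMat_ne_zero h
    have h1 : X ⟨a, ha⟩ ⟨b, hb⟩ ≠ 0 := by rwa [← extMat_mk X ⟨a, ha⟩ ⟨b, hb⟩]
    exact ⟨hX.frac.adj _ _ h1, ha, hb⟩
  · by_cases ha : a ∈ Sᶜ
    · have := extMat_row X ⟨a, ha⟩
      simp only at this
      rw [this]
      exact hX.frac.row _
    · rw [Finset.sum_eq_zero fun b _ => extMat_of_not_left X ha b]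
      exact zero_le_one
  · have hD0 : ∀ a b, ¬ (a ∈ Sᶜ ∧ b ∈ Sᶜ) → D a b = 0 := fun a b h => h0 a b (dif_neg h)
    have h1 := hX.rigid (fun a b => D a b) (fun a b => hD a b)
      (fun a b h => h0 a b (by rw [extMat_mk, h])) (fun a h => by
        rw [← sum_eq_sum_subtype (U := Sᶜ) (fun b => D a b) fun b hb => hD0 a b fun h => hb h.2]
        exact hrow a (by rw [extMat_row, h]))
    funext a b
    by_cases h : a ∈ Sᶜ ∧ b ∈ Sᶜ
    · exact congrFun (congrFun h1 ⟨a, h.1⟩) ⟨b, h.2⟩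
    · exact hD0 a b h
  · have hYS : ∀ a b, Y a b ≠ 0 → a ∈ Sᶜ ∧ b ∈ Sᶜ := fun a b h => (hY.adj a b h).2
    rw [matVal_eq_matVal_subtype (U := Sᶜ) w hYS,
      matVal_eq_matVal_subtype (U := Sᶜ) w (Y := extMat X) fun a b h => mem_of_extMat_ne_zero h]
    simp only [extMat_mk]
    refine hX.max _ ⟨fun a b => hY.symm a b, fun a b => hY.nonneg a b,
      fun a b h => (hY.adj a b h).1, fun a => ?_⟩
    rw [← sum_eq_sum_subtype (U := Sᶜ) (fun b => Y a b) fun b hb => by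
      by_contra h
      exact hb (hYS a b h).2]
    exact hY.row a

/-- The extension vanishes outside `U`, so a half-valued cycle stays in `U` and comes from a cycle
there. -/
lemma ncard_oddCycleSets_extMat_le [Finite V] {U : Set V} (X : U → U → ℝ) :
    (oddCycleSets (extMat X)).ncard ≤ (oddCycleSets X).ncard := by
  have hsub : oddCycleSets (extMat X) ⊆ (fun C => Sym2.map Subtype.val '' C) '' oddCycleSets X := by
    rintro _ ⟨hC, u, p, hp, hodd, rfl⟩
    have hU : ∀ a ∈ p.support, a ∈ U := by
      intro a ha
      obtain ⟨b, -, -, hb, -⟩ := exists_two_edges hp ha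
      exact (mem_of_extMat_ne_zero (b := b) (X := X) (by rw [hC a b hb]; norm_num)).1
    let q := p.induce U hU
    have hq : q.map (SimpleGraph.Embedding.induce U).toHom = p := p.map_induce hU
    have hedges : p.edges = q.edges.map (Sym2.map Subtype.val) := 
      (congrArg (fun r : (⊤ : SimpleGraph V).Walk u u => r.edges) hq).symm.trans
        (SimpleGraph.Walk.edges_map (SimpleGraph.Embedding.induce U).toHom q)
    have hlength : p.length = q.length :=
      (congrArg (fun r : (⊤ : SimpleGraph V).Walk u u => r.length) hq).symm.trans
        (SimpleGraph.Walk.length_map (SimpleGraph.Embedding.induce U).toHom q)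
    have himg : Sym2.map Subtype.val '' {e | e ∈ q.edges} = {e | e ∈ p.edges} := by
      ext e
      simp only [Set.mem_image, Set.mem_ofPred_eq, hedges, List.mem_map]
    refine ⟨{e | e ∈ q.edges}, ⟨fun a b hab => ?_, _, q.mapLe le_top, ?_, ?_, ?_⟩, himg⟩
    · rw [← extMat_mk X a b]
      exact hC _ _ (himg ▸ ⟨s(a, b), hab, rfl⟩)
    · refine SimpleGraph.Walk.IsCycle.mapLe le_top ?_
      exact SimpleGraph.Walk.IsCycle.of_map (f := (SimpleGraph.Embedding.induce U).toHom)
        (hq.symm ▸ hp)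
    · rw [SimpleGraph.Walk.mapLe, SimpleGraph.Walk.length_map]
      rwa [← hlength]
    · rw [SimpleGraph.Walk.edges_mapLe_eq_edges]
  exact (Set.ncard_le_ncard hsub (Set.toFinite _)).trans (Set.ncard_image_le (Set.toFinite _))

open Classical in
/-- The matrix of a matching. -/
noncomputable def matchingMat {G : SimpleGraph V} (M : G.Subgraph) (a b : V) : ℝ :=
  if M.Adj a b then 1 else 0

lemma oddCycleSets_matchingMat {G : SimpleGraph V} (M : G.Subgraph) :
    oddCycleSets (matchingMat M) = ∅ := by
  rw [Set.eq_empty_iff_forall_notMem]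
  rintro _ ⟨hC, u, p, hp, -, rfl⟩
  obtain ⟨b, -, -, hb, -⟩ := exists_two_edges hp p.start_mem_support
  have := hC u b hb
  unfold matchingMat at this
  split_ifs at this <;> norm_num at this

variable [Fintype V]

/-- This is strong duality, obtained by adding vertices one at a time to the empty set with
`exists_add_vertex`. -/
lemma exists_complementary_pair (G : SimpleGraph V) (w : Sym2 V → ℝ) (U : Finset V) :
    ∃ X y, IsFracMat (restrictTo G U) X ∧ IsRigid X ∧ IsCover (restrictTo G U) w y ∧
      IsComplementary w X y := by
  classical
  induction U using Finset.induction_on with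
  | empty =>
    refine ⟨0, 0, ⟨by simp, by simp, by simp, by simp⟩, fun D _ h _ => ?_, ⟨by simp, ?_⟩,
      ⟨by simp, by simp⟩⟩
    · funext a b
      exact h a b rfl
    · rintro a b ⟨-, h, -⟩
      simp at h
  | insert v U hv ih =>
    obtain ⟨X', y', h1, h2, h3, h4⟩ := ih
    obtain ⟨X, y, h5, h6, h7, h8, -⟩ := exists_add_vertex (G := restrictTo G (insert v U : Finset V))
      (v := v) (by rw [Finset.coe_insert]; exact restrictTo_adj_iff (by simpa using hv)) h1 h2 h3 h4
    exact ⟨X, y, h5, h6, h7, h8⟩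

lemma exists_add_vertices {G : SimpleGraph V} {w : Sym2 V → ℝ} {U : Finset V} {X' : V → V → ℝ}
    (hX' : IsOptMat (restrictTo G U) w X') [DecidableEq V] (T : Finset V) (hT : Disjoint T U) :
    ∃ X y, IsFracMat (restrictTo G (T ∪ U : Finset V)) X ∧ IsRigid X ∧
      IsCover (restrictTo G (T ∪ U : Finset V)) w y ∧ IsComplementary w X y ∧
      (oddCycleSets X).ncard ≤ (oddCycleSets X').ncard + T.card := by
  induction T using Finset.induction_on with
  | empty =>
    -- `X'` is optimal but comes without a cover; the one complementary to `X₀` also fits `X'`,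
    -- since the values agree.
    obtain ⟨X₀, y, h1, -, h2, h3⟩ := exists_complementary_pair G w U
    rw [Finset.empty_union]
    exact ⟨X', y, hX'.frac, hX'.rigid, h2, isCompl_of_le h1 h2 h3 hX'.frac (hX'.max _ h1), by simp⟩
  | insert v T hv ih =>
    rw [Finset.disjoint_insert_left] at hT
    obtain ⟨X, y, h1, h2, h3, h4, h5⟩ := ih hT.2
    obtain ⟨X₁, y₁, h6, h7, h8, h9, h10⟩ := exists_add_vertex
      (G := restrictTo G (insert v T ∪ U : Finset V)) (v := v) (by
        rw [Finset.insert_union, Finset.coe_insert]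
        exact restrictTo_adj_iff (by simp [hv, hT.1])) h1 h2 h3 h4
    refine ⟨X₁, y₁, h6, h7, h8, h9, ?_⟩
    rw [Finset.card_insert_of_notMem hv]
    omega

/-- Deleting `S` decreases `γ` by at most `|S|`. -/
theorem gamma_le_gamma_deleteVerts_add (G : SimpleGraph V) (w : Sym2 V → ℝ) (S : Finset V) :
    gamma G w ≤ gamma (deleteVerts G (S : Set V)) (deleteWeight w S) + S.card := by
  classical
  obtain ⟨X₁, hX₁, hcard⟩ := exists_isOptMat_ncard_eq_gamma (deleteVerts G (S : Set V))
    (deleteWeight w S)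
  have hX' := isOptMat_extMat hX₁
  have hX'' : IsOptMat (restrictTo G (Sᶜ : Finset V)) w (extMat X₁) := by
    rwa [Finset.coe_compl]
  obtain ⟨X, y, h1, h2, h3, h4, h5⟩ := exists_add_vertices hX'' S disjoint_compl_right
  have hG : restrictTo G (S ∪ Sᶜ : Finset V) = G := by
    rw [Finset.union_compl, Finset.coe_univ, restrictTo_univ]
  rw [hG] at h1 h3
  have h6 := gamma_le_ncard (w := w) ⟨h1, h2, fun Y hY => max_of_isCompl h1 h3 h4 Y hY⟩
  have h7 := ncard_oddCycleSets_extMat_le X₁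
  omega

lemma matchingMat_row {G : SimpleGraph V} {M : G.Subgraph} (hM : M.IsMatching) {a b : V}
    (hab : M.Adj a b) : ∑ c, matchingMat M a c = 1 := by
  rw [Finset.sum_eq_single b]
  · simp [matchingMat, hab]
  · intro c _ hc
    exact if_neg fun h => hc (hM.eq_of_adj_left h hab)
  · simp

lemma isFracMat_matchingMat {G : SimpleGraph V} {M : G.Subgraph} (hM : M.IsMatching) :
    IsFracMat G (matchingMat M) := by
  refine ⟨fun a b => ?_, fun a b => ?_, fun a b h => ?_, fun a => ?_⟩
  · unfold matchingMat
    rw [M.adj_comm]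
  · unfold matchingMat
    split_ifs <;> norm_num
  · by_contra hn
    exact h (if_neg fun h' => hn h'.adj_sub)
  · by_cases h : ∃ b, M.Adj a b
    · obtain ⟨b, hb⟩ := h
      exact (matchingMat_row hM hb).le
    · refine (Finset.sum_eq_zero fun b _ => ?_).le.trans zero_le_one
      exact if_neg fun hb => h ⟨b, hb⟩

/-- A matched row is tight and has a single support entry, so a perturbation vanishes there. -/
lemma isRigid_matchingMat {G : SimpleGraph V} {M : G.Subgraph} (hM : M.IsMatching) :
    IsRigid (matchingMat M) := by
  intro D _ h0 hrow
  have hD : ∀ a b, ¬ M.Adj a b → D a b = 0 := fun a b h => h0 a b (if_neg h)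
  funext a b
  by_cases h : M.Adj a b
  · have h1 := hrow a (matchingMat_row hM h)
    rwa [Finset.sum_eq_single b (fun c _ hc => hD a c fun h' => hc (hM.eq_of_adj_left h' h))
      (by simp)] at h1
  · exact hD a b h

lemma matVal_matchingMat {G : SimpleGraph V} (w : Sym2 V → ℝ) {M : G.Subgraph}
    (hM : M.IsMatching) : matVal w (matchingMat M) = ∑ᶠ e ∈ M.edgeSet, w e := by
  classical
  have hX := isFracMat_matchingMat hM
  rw [← toMat_ofMat G hX.symm hX.adj, ← value_eq_matVal]
  unfold value
  rw [finsum_mem_def, finsum_eq_sum_of_fintype, finsum_eq_sum_of_fintype]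
  refine Fintype.sum_of_injective Subtype.val Subtype.val_injective _ _ (fun e he => ?_) ?_
  · rw [Set.indicator_of_notMem]
    intro h
    exact he ⟨⟨e, M.edgeSet_subset h⟩, rfl⟩
  · rintro ⟨e, he⟩
    induction e with
    | _ a b =>
      rw [ofMat_mk G hX.symm]
      by_cases h : M.Adj a b <;> simp [matchingMat, h]

/-- In a stable graph, a maximum-weight matching is a basic maximum-weight fractional matching. -/
lemma gamma_eq_zero_of_isStable {G : SimpleGraph V} {w : Sym2 V → ℝ} (h : IsStable G w) :
    gamma G w = 0 := by
  obtain ⟨M, hM, hMval⟩ : nu G w ∈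
      {r | ∃ M : G.Subgraph, M.IsMatching ∧ r = ∑ᶠ e ∈ M.edgeSet, w e} := by
    -- The supremum is attained because there are finitely many subgraphs.
    refine Set.Nonempty.csSup_mem ⟨_, ⊥, by simp [SimpleGraph.Subgraph.IsMatching], rfl⟩ ?_
    refine (Set.finite_range fun M : G.Subgraph => ∑ᶠ e ∈ M.edgeSet, w e).subset ?_
    rintro _ ⟨M, -, rfl⟩
    exact ⟨M, rfl⟩
  have hmax : ∀ Y, IsFracMat G Y → matVal w Y ≤ matVal w (matchingMat M) := by
    intro Y hY
    rw [matVal_matchingMat w hM, ← hMval, h]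
    obtain ⟨x, hx⟩ := exists_isBasicMax G w
    refine le_csSup ⟨value G w x, ?_⟩ ⟨ofMat G Y, ?_, ?_⟩
    · rintro _ ⟨x', hx', rfl⟩
      exact hx.2 x' hx'
    · rw [← isFracMat_toMat, toMat_ofMat G hY.symm hY.adj]
      exact hY
    · rw [value_eq_matVal, toMat_ofMat G hY.symm hY.adj]
  have := gamma_le_ncard ⟨isFracMat_matchingMat hM, isRigid_matchingMat hM, hmax⟩
  rw [oddCycleSets_matchingMat, Set.ncard_empty] at this
  omega

end

end WGraph

theorem mainTheorem4 {V : Type*} [Finite V] (G : SimpleGraph V) (w : Sym2 V → ℝ)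
    (hw : ∀ e ∈ G.edgeSet, 0 ≤ w e) :
    (∀ v : V, (WGraph.gamma (WGraph.deleteVerts G {v}) (WGraph.deleteWeight w {v}) : ℤ) ≥
      (WGraph.gamma G w : ℤ) - 1) ∧
    ∀ S : Finset V, WGraph.IsVertexStabilizer G w (S : Set V) →
      S.card ≥ WGraph.gamma G w := by
  classical
  have := Fintype.ofFinite V
  refine ⟨fun v => ?_, fun S hS => ?_⟩
  · have h := WGraph.gamma_le_gamma_deleteVerts_add G w {v}
    rw [Finset.coe_singleton, Finset.card_singleton] at h
    omega
  · have h := WGraph.gamma_le_gamma_deleteVerts_add G w S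
    rwa [WGraph.gamma_eq_zero_of_isStable hS, zero_add] at h
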